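/- Let $\mathcal H_1,\dots,\mathcal H_k$ and $\mathcal K_1,\dots,\mathcal K_k$ be finite-dimensional complex Hilbert spaces and let $\psi\in\mathcal H_1\otimes\dots\otimes\mathcal H_k$ and $\varphi\in\mathcal K_1\otimes\dots\otimes\mathcal K_k$ be unit vectors. Let $A_j(z)$ ($j=1,\dots,k$) be Laurent polynomials in $z$ whose coefficients are linear maps $\mathcal H_j\to\mathcal K_j$, and write $A(z)=A_1(z)\otimes\dots\otimes A_k(z)$. Suppose that $A(z)\psi=\varphi+O(z)$ is a degeneration of error degree $e$, i.e. $A(z)\psi=\sum_{h=0}^{e}z^h\varphi_h$ is a polynomial in $z$ of degree at most $e$ with constant term $\varphi_0=\varphi$. Suppose moreover that $A(z)\neq 0$ for every $z\in\mathbb C\setminus\{0\}$, and that the Laurent polynomial $A(z)$ contains terms with positive as well as terms with negative powers of $z$. Then $\psi$ can be asymptotically transformed into $\varphi$ by LOCC at rate $1$ with strong converse exponent at most $$2\inf_{\sigma}\ \sup_{z\in\operatorname{supp}\sigma}\left[\log\|A(z)\|+e\int_{\mathbb C}\log\frac{|t|}{|z-t|}\,d\sigma(t)\right],$$ where the infimum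 is over all Borel probability measures $\sigma$ on $\mathbb C$. Here $\log$ is the logarithm to base $2$, $\|\cdot\|$ is the operator norm, the expression in brackets takes values in the extended reals, it is understood to be $+\infty$ at the pole $z=0$ of $A$, and $0\cdot\infty=0$ (relevant only if $e=0$). The conclusion means that there are a real number $r$ not exceeding this bound, natural numbers $m_n$ with $m_n/n\to1$, and, for every $n$, an LOCC protocol (local measurements and classical communication among the $k$ parties, with finitely many rounds) that transforms $\psi^{\otimes n}$ into $\varphi^{\otimes m_n}$ with success probability at least $2^{-rn+o(n)}$. -/

import Mathlib

open MeasureTheory Filter Topology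
open scoped ENNReal LaurentPolynomial Matrix

noncomputable section

namespace Degeneration

/-- Vectors of `⊗_j ℂ^{I j}`, written in the product basis. Every finite-dimensional `k`-partite
Hilbert space is of this form (choose an orthonormal basis in each factor). -/
abbrev Tensor {k : ℕ} (I : Fin k → Type) : Type := (∀ j, I j) → ℂ

/-- `‖ψ‖ = 1` for the norm of the Hilbert space `⊗_j ℂ^{I j}`. -/
def IsUnitVector {k : ℕ} {I : Fin k → Type} [∀ j, Fintype (I j)] (ψ : Tensor I) : Prop :=
  ‖(WithLp.toLp 2 ψ : EuclideanSpace ℂ (∀ j, I j))‖ = 1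

/-- The matrix of `B_1 ⊗ ⋯ ⊗ B_k`. -/
def kron {R : Type} [CommSemiring R] {k : ℕ} {I J : Fin k → Type}
    (B : ∀ j, Matrix (J j) (I j) R) : Matrix (∀ j, J j) (∀ j, I j) R :=
  fun x y => ∏ j, B j (x j) (y j)

/-- `ψ^{⊗ n}` as a `k`-partite vector: party `j` holds the space `(ℂ^{I j})^{⊗ n}`. -/
def tensorPow {k : ℕ} {I : Fin k → Type} (ψ : Tensor I) (n : ℕ) :
    Tensor (fun j => Fin n → I j) :=
  fun x => ∏ a : Fin n, ψ (fun j => x j a)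

/-! ### LOCC transformations -/

/-- `LOCC φ ψ p`: there is an LOCC protocol with finitely many rounds that, started from `ψ`, ends
with the unit vector `φ` (and announces success) with probability `p`.

Intermediate states are kept unnormalized: the squared norm of the vector in a branch is the
probability of that branch, so the probability of obtaining `φ` in a branch with
final vector `c • φ` is `|c|²`.
A round consists of a measurement of one party `a`, with Kraus operators `K m a` that may map to
arbitrary finite-dimensional spaces, the broadcast of the outcome `m`, and the application of local
isometries `K m j` by the other parties `j`, which may depend on `m` (as everything that follows
may). Since the measurements are described by Kraus operators, local ancillas, discarding of
subsystems and local and shared randomness are included. -/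
inductive LOCC {k : ℕ} {J : Fin k → Type} [∀ j, Fintype (J j)] [∀ j, DecidableEq (J j)]
    (φ : Tensor J) : ∀ {I : Fin k → Type} [∀ j, Fintype (I j)] [∀ j, DecidableEq (I j)],
    Tensor I → ℝ → Prop
  | success (c : ℂ) : LOCC φ (c • φ) (‖c‖ ^ 2)
  | failure {I : Fin k → Type} [∀ j, Fintype (I j)] [∀ j, DecidableEq (I j)] (ψ : Tensor I) :
      LOCC φ ψ 0
  | round {I : Fin k → Type} [∀ j, Fintype (I j)] [∀ j, DecidableEq (I j)] (ψ : Tensor I)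
      (a : Fin k) (N : ℕ) (I' : Fin N → Fin k → Type)
      [∀ m j, Fintype (I' m j)] [∀ m j, DecidableEq (I' m j)]
      (K : ∀ m j, Matrix (I' m j) (I j) ℂ) (p : Fin N → ℝ)
      (measurement : ∑ m, (K m a)ᴴ * K m a = 1)
      (isometry : ∀ m j, j ≠ a → (K m j)ᴴ * K m j = 1)
      (next : ∀ m, LOCC φ (kron (K m) *ᵥ ψ) (p m)) :
      LOCC φ ψ (∑ m, p m)

/-- `ψ` can be asymptotically transformed into `φ` by LOCC with rate `R` and strong converse
exponent `r`: there are protocols for `ψ^{⊗ n} → φ^{⊗ (R n + o(n))}` whose success probability is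
at least `2 ^ (- r n + o(n))`. -/
def AsymptoticallyTransforms {k : ℕ} {I J : Fin k → Type}
    [∀ j, Fintype (I j)] [∀ j, DecidableEq (I j)] [∀ j, Fintype (J j)] [∀ j, DecidableEq (J j)]
    (ψ : Tensor I) (φ : Tensor J) (R r : ℝ) : Prop :=
  ∃ (m : ℕ → ℕ) (p : ℕ → ℝ) (δ : ℕ → ℝ),
    Tendsto (fun n : ℕ => (m n : ℝ) / n) atTop (𝓝 R) ∧
    Tendsto (fun n : ℕ => δ n / n) atTop (𝓝 0) ∧
    ∀ n : ℕ, (2 : ℝ) ^ (-(r * n) + δ n) ≤ p n ∧ LOCC (tensorPow φ (m n)) (tensorPow ψ n) (p n)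

/-! ### Degenerations -/

/-- `(A_1(z) ⊗ ⋯ ⊗ A_k(z)) ψ = φ + O(z)`, where the right-hand side is a polynomial in `z` of
degree at most `e` with constant term `φ`, and the `A_j` are matrices of Laurent polynomials. -/
def IsDegeneration {k : ℕ} {I J : Fin k → Type} [∀ j, Fintype (I j)]
    (ψ : Tensor I) (φ : Tensor J) (A : ∀ j, Matrix (J j) (I j) ℂ[T;T⁻¹]) (e : ℕ) : Prop :=
  ∃ P : (∀ j, J j) → Polynomial ℂ,
    (∀ x, (P x).natDegree ≤ e) ∧ (∀ x, (P x).coeff 0 = φ x) ∧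
    kron A *ᵥ (fun y => LaurentPolynomial.C (ψ y)) = fun x => Polynomial.toLaurent (P x)

/-- The operator `A_1(z) ⊗ ⋯ ⊗ A_k(z)` at a point `z ≠ 0`. -/
def kronAt {k : ℕ} {I J : Fin k → Type} (A : ∀ j, Matrix (J j) (I j) ℂ[T;T⁻¹]) (z : ℂˣ) :
    Matrix (∀ j, J j) (∀ j, I j) ℂ :=
  kron fun j => (A j).map (LaurentPolynomial.eval₂ (RingHom.id ℂ) z)

/-- The operator norm of a matrix with respect to the Euclidean norms. -/
def opNorm {X Y : Type} [Fintype X] [Fintype Y] [DecidableEq X] (M : Matrix Y X ℂ) : ℝ :=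
  ‖LinearMap.toContinuousLinearMap (Matrix.toEuclideanLin M)‖

/-! ### The exponent -/

/-- The logarithm to base `2`, with `log 0 = -∞` and `log ∞ = ∞`. -/
def log2 (x : ℝ≥0∞) : EReal := ENNReal.log x / ((Real.log 2 : ℝ) : EReal)

/-- `∫ log (|t| / |z - t|) dσ(t)`, with values in the extended reals (the integral of the positive
part minus the integral of the negative part). The integrand is `∞` at `t = z ≠ 0`. If `0` is not
in the support of `σ` then the integral of the negative part is finite. -/
def potential (σ : Measure ℂ) (z : ℂ) : EReal :=
  ((∫⁻ t, (log2 (‖t‖ₑ / ‖z - t‖ₑ)).toENNReal ∂σ : ℝ≥0∞) : EReal) -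
    ((∫⁻ t, (-log2 (‖t‖ₑ / ‖z - t‖ₑ)).toENNReal ∂σ : ℝ≥0∞) : EReal)

open Classical in
/-- `log ‖A_1(z) ⊗ ⋯ ⊗ A_k(z)‖ + e ∫ log (|t| / |z - t|) dσ(t)`. At the pole `z = 0` of the operator
the first term is `∞`, and so is the sum. -/
def exponentAt {k : ℕ} {I J : Fin k → Type} [∀ j, Fintype (I j)] [∀ j, DecidableEq (I j)]
    [∀ j, Fintype (J j)] (A : ∀ j, Matrix (J j) (I j) ℂ[T;T⁻¹]) (e : ℕ) (σ : Measure ℂ) (z : ℂ) :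
    EReal :=
  if h : z = 0 then ⊤
  else log2 (ENNReal.ofReal (opNorm (kronAt A (Units.mk0 z h)))) + (e : EReal) * potential σ z

/-- `2 inf_σ sup_{z ∈ supp σ} [log ‖A_1(z) ⊗ ⋯ ⊗ A_k(z)‖ + e ∫ log (|t| / |z - t|) dσ(t)]`, the infimum
being over all Borel probability measures on `ℂ`. -/
def exponentBound {k : ℕ} {I J : Fin k → Type} [∀ j, Fintype (I j)] [∀ j, DecidableEq (I j)]
    [∀ j, Fintype (J j)] (A : ∀ j, Matrix (J j) (I j) ℂ[T;T⁻¹]) (e : ℕ) : EReal :=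
  2 * ⨅ σ : ProbabilityMeasure ℂ, ⨆ z ∈ (σ : Measure ℂ).support, exponentAt A e σ z

end Degeneration

end

open Degeneration

namespace Degeneration

noncomputable section

open scoped ComplexOrder MatrixOrder

/-! `A(z)^{⊗n} ψ^{⊗n}` is a polynomial in `z` of degree at most `n e` with constant term `φ^{⊗n}`.
If nodes `z_i ≠ 0` and weights `w_i` satisfy `∑ w_i f(z_i) = f(0)` for all `f` of degree at most `n
e`, then `∑ w_i A(z_i)^{⊗n}` sends `ψ^{⊗n}` to `φ^{⊗n}`. This sum is not a product of local
operators, but it becomes one when the parties share a GHZ state whose levels label the nodes: party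
`j` applies a sum over `i` of `A_j(z_i)^{⊗n} ⊗ ⟨i|`, suitably scaled. A product of local operators
succeeds with probability the inverse square of the product of bounds on their norms
(`LOCC.of_kron_mulVec`), and that product is at most `∑ |w_i| ‖A(z_i)‖^n` up to a factor polynomial
in `n`. The inverse square is the source of the factor 2 in the exponent.

The GHZ state needs only `O(log n)` qubit levels, extracted from `O(log n)` further copies of `ψ`,
so the rate stays 1. If `ψ` is not correlated across all parties, it is a product over blocks and
GHZ states exist only inside blocks (`exists_block_decomposition`). The degeneration then also
factors (`IsDegeneration.exists_blocks`), each block interpolates separately, and by duality the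
weights can be split over the blocks at bounded cost (`exists_block_weights`).
`IsDegeneration.exists_protocol` combines these ingredients.

For the weights, sample slightly more than `n e` nodes from `σ`. The Lagrange weight at `z` has
modulus `∏ |t| / |z - t|` over the other nodes `t`, and by the law of large numbers this is about
`2` to the power `n e` times the potential of `σ` at `z`. Multiplied by `‖A(z)‖^n` it is at most
`2^{n(L + ε)}` when the supremum over the support is at most `L` (`interpolates_of_measure`). Limits
`ε → 0` and a diagonal choice over `n` finish the argument. -/

theorem kron_mul {k : ℕ} {I J L : Fin k → Type} [∀ j, Fintype (J j)]
    {R : Type} [CommSemiring R]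
    (B : ∀ j, Matrix (L j) (J j) R) (C : ∀ j, Matrix (J j) (I j) R) :
    kron B * kron C = kron fun j => B j * C j := by
  ext x y
  simp only [kron, Matrix.mul_apply, ← Finset.prod_mul_distrib]
  rw [Finset.prod_univ_sum, Fintype.piFinset_univ]

/-! ### Products of local contractions as LOCC protocols -/

section Round

variable {k : ℕ} {I J : Fin k → Type} [∀ j, Fintype (I j)] [∀ j, DecidableEq (I j)]
  [∀ j, Fintype (J j)] [∀ j, DecidableEq (J j)]

/-- The index types after party `a` has measured: in branch `0` it holds `J a`, in branch `1` it
still holds `I a`. -/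
abbrev RoundIndex (I J : Fin k → Type) (a : Fin k) (m : Fin 2) (j : Fin k) : Type :=
  {_i : I j // m = 1 ∨ j ≠ a} ⊕ {_i : J j // m = 0 ∧ j = a}

/-- The Kraus operators of the round in which party `a` applies `B a` (branch `0`), with
complementary operator `Q a` (branch `1`). -/
def roundKraus (B : ∀ j, Matrix (J j) (I j) ℂ) (Q : ∀ j, Matrix (I j) (I j) ℂ) (a : Fin k)
    (m : Fin 2) (j : Fin k) : Matrix (RoundIndex I J a m j) (I j) ℂ :=
  Matrix.of fun p y => Sum.elim
    (fun i => if m = 1 ∧ j = a then Q j i.1 y else (1 : Matrix (I j) (I j) ℂ) i.1 y)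
    (fun i => B j i.1 y) p

/-- What remains to be applied after `roundKraus` in branch `0`. -/
def roundRest (B : ∀ j, Matrix (J j) (I j) ℂ) (a : Fin k) (j : Fin k) :
    Matrix (J j) (RoundIndex I J a 0 j) ℂ :=
  Matrix.of fun x p => Sum.elim (fun i => B j x i.1)
    (fun i => (1 : Matrix (J j) (J j) ℂ) x i.1) p

theorem sum_subtype_const {α : Type} [Fintype α] {p : Prop} [Decidable p] (f : α → ℂ) :
    ∑ i : {_i : α // p}, f i.1 = if p then ∑ i, f i else 0 := by
  split_ifs with h
  · exact Fintype.sum_equiv (Equiv.subtypeUnivEquiv fun _ => h) _ _ fun _ => rfl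
  · have : IsEmpty {_i : α // p} := ⟨fun i => h i.2⟩
    simp

theorem roundRest_mul (B : ∀ j, Matrix (J j) (I j) ℂ) (Q : ∀ j, Matrix (I j) (I j) ℂ)
    (a j : Fin k) : roundRest B a j * roundKraus B Q a 0 j = B j := by
  ext x y
  simp only [roundRest, roundKraus, Matrix.mul_apply, Fintype.sum_sum_type, Matrix.of_apply,
    Sum.elim_inl, Sum.elim_inr]
  rw [sum_subtype_const (fun i => B j x i * if (0 : Fin 2) = 1 ∧ j = a then Q j i y else
      (1 : Matrix (I j) (I j) ℂ) i y), sum_subtype_const (fun i => (1 : Matrix (J j) (J j) ℂ) x i *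
      B j i y)]
  by_cases h : j = a <;> simp [h, ← Matrix.mul_apply]

theorem roundKraus_gram (B : ∀ j, Matrix (J j) (I j) ℂ) (Q : ∀ j, Matrix (I j) (I j) ℂ)
    (a : Fin k) (m : Fin 2) (j : Fin k) :
    (roundKraus B Q a m j)ᴴ * roundKraus B Q a m j =
      if j = a then if m = 0 then (B j)ᴴ * B j else (Q j)ᴴ * Q j else 1 := by
  ext x y
  simp only [roundKraus, Matrix.mul_apply, Fintype.sum_sum_type, Matrix.of_apply,
    Sum.elim_inl, Sum.elim_inr, Matrix.conjTranspose_apply]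
  rw [sum_subtype_const (fun i => star (if m = 1 ∧ j = a then Q j i x else
      (1 : Matrix (I j) (I j) ℂ) i x) * if m = 1 ∧ j = a then Q j i y else
      (1 : Matrix (I j) (I j) ℂ) i y), sum_subtype_const (fun i => star (B j i x) * B j i y)]
  fin_cases m <;> by_cases h : j = a <;>
    simp [h, Matrix.mul_apply, Matrix.one_apply, apply_ite, eq_comm]

theorem roundRest_gram (B : ∀ j, Matrix (J j) (I j) ℂ) (a j : Fin k)
    (h : j = a ∨ (B j)ᴴ * B j = 1) : (roundRest B a j)ᴴ * roundRest B a j = 1 := by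
  ext p q
  rw [Matrix.mul_apply]
  rcases p with ⟨x, hx⟩ | ⟨x, hx⟩ <;> rcases q with ⟨y, hy⟩ | ⟨y, hy⟩ <;>
    simp only [roundRest, Matrix.of_apply, Sum.elim_inl, Sum.elim_inr, Matrix.conjTranspose_apply]
  · have h1 := congrFun (congrFun (h.resolve_left (by simpa using hx)) x) y
    simpa [Matrix.mul_apply, Matrix.one_apply] using h1
  · exact absurd hy.2 (by simpa using hx)
  · exact absurd hx.2 (by simpa using hy)
  · simp [Matrix.one_apply, eq_comm, apply_ite]

theorem roundRest_contraction (B : ∀ j, Matrix (J j) (I j) ℂ) (a j : Fin k)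
    (h : (1 - (B j)ᴴ * B j).PosSemidef) :
    (1 - (roundRest B a j)ᴴ * roundRest B a j).PosSemidef := by
  by_cases hj : j = a
  · rw [roundRest_gram B a j (Or.inl hj), sub_self]; exact Matrix.PosSemidef.zero
  · have : 1 - (roundRest B a j)ᴴ * roundRest B a j =
        (1 - (B j)ᴴ * B j).submatrix (Sum.elim (fun i => i.1) (fun i => absurd i.2.2 hj))
          (Sum.elim (fun i => i.1) (fun i => absurd i.2.2 hj)) := by
      ext p q
      rcases p with ⟨x, hx⟩ | ⟨x, hx⟩
      swap
      · exact absurd hx.2 hj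
      rcases q with ⟨y, hy⟩ | ⟨y, hy⟩
      swap
      · exact absurd hy.2 hj
      simp [roundRest, Matrix.mul_apply, Matrix.one_apply]
    rw [this]
    exact h.submatrix _

end Round

/-- Induction on the set `S` of parties whose operator need not yet be an isometry. Party `a`
measures with Kraus operators `B a` and `Q`, where `Qᴴ * Q = 1 - (B a)ᴴ * B a`. The `Q` outcome is
given up, and after the other one party `a` has only an identity left to apply. The local spaces
change in each round, so `I` is quantified inside the induction. For empty `S` one round with a
single outcome applies all isometries; `hk` supplies its nominal measurer. -/
theorem LOCC.of_contraction_aux {k : ℕ} (hk : 0 < k) {J : Fin k → Type} [∀ j, Fintype (J j)]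
    [∀ j, DecidableEq (J j)] (φ : Tensor J) (c : ℂ) (S : Finset (Fin k)) :
    ∀ {I : Fin k → Type} [∀ j, Fintype (I j)] [∀ j, DecidableEq (I j)] (ψ : Tensor I)
      (B : ∀ j, Matrix (J j) (I j) ℂ), (∀ j, (1 - (B j)ᴴ * B j).PosSemidef) →
      (∀ j, j ∉ S → (B j)ᴴ * B j = 1) → kron B *ᵥ ψ = c • φ → LOCC φ ψ (‖c‖ ^ 2) := by
  induction S using Finset.induction_on with
  | empty =>
    intro I _ _ ψ B _ hi h
    have := LOCC.round (φ := φ) ψ ⟨0, hk⟩ 1 (fun _ => J) (fun _ => B) (fun _ => ‖c‖ ^ 2)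
      (by simpa using hi _ (by simp)) (fun _ j _ => hi j (by simp))
      (fun _ => by rw [h]; exact LOCC.success c)
    simpa using this
  | insert a S _ ih =>
    intro I _ _ ψ B hB hi h
    have hQ : ∀ j, ∃ Q : Matrix (I j) (I j) ℂ, Qᴴ * Q = 1 - (B j)ᴴ * B j := fun j => by
      obtain ⟨Q, hQ⟩ := CStarAlgebra.nonneg_iff_eq_star_mul_self.1 (hB j).nonneg
      exact ⟨Q, hQ.symm⟩
    choose Q hQ using hQ
    have := LOCC.round (φ := φ) ψ a 2 (RoundIndex I J a) (roundKraus B Q a) ![‖c‖ ^ 2, 0]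
      (by simp [Fin.sum_univ_two, roundKraus_gram, hQ])
      (fun m j hj => by simp [roundKraus_gram, hj])
      (by
        intro m
        fin_cases m
        · refine ih _ (roundRest B a) (fun j => roundRest_contraction B a j (hB j))
            (fun j hj => roundRest_gram B a j ?_) ?_
          · by_cases hja : j = a
            · exact Or.inl hja
            · exact Or.inr (hi j (by simp [hja, hj]))
          · change kron (roundRest B a) *ᵥ (kron (roundKraus B Q a 0) *ᵥ ψ) = _
            rw [Matrix.mulVec_mulVec, kron_mul]
            simp_rw [roundRest_mul]
            exact h
        · exact LOCC.failure _)
    simpa [Fin.sum_univ_two] using this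

/-- A product of local contractions mapping `ψ` to `c • φ` can be implemented by LOCC. -/
theorem LOCC.of_contraction {k : ℕ} (hk : 0 < k) {I J : Fin k → Type} [∀ j, Fintype (I j)]
    [∀ j, DecidableEq (I j)] [∀ j, Fintype (J j)] [∀ j, DecidableEq (J j)]
    {ψ : Tensor I} {φ : Tensor J} {c : ℂ} {B : ∀ j, Matrix (J j) (I j) ℂ}
    (hB : ∀ j, (1 - (B j)ᴴ * B j).PosSemidef) (h : kron B *ᵥ ψ = c • φ) :
    LOCC φ ψ (‖c‖ ^ 2) :=
  LOCC.of_contraction_aux hk φ c Finset.univ ψ B hB (by simp) h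

end

noncomputable section

/-! ### Operator norms and their multiplicativity under tensor products -/

section OpNorm

variable {X Y X₁ X₂ Y₁ Y₂ : Type} [Fintype X] [Fintype Y] [DecidableEq X]
  [Fintype X₁] [Fintype X₂] [Fintype Y₁] [Fintype Y₂] [DecidableEq X₁] [DecidableEq X₂]

theorem opNorm_nonneg (M : Matrix Y X ℂ) : 0 ≤ opNorm M := norm_nonneg _

theorem norm_mulVec_le (M : Matrix Y X ℂ) (v : X → ℂ) :
    ‖(WithLp.toLp 2 (M *ᵥ v) : EuclideanSpace ℂ Y)‖ ≤
      opNorm M * ‖(WithLp.toLp 2 v : EuclideanSpace ℂ X)‖ :=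
  (LinearMap.toContinuousLinearMap (Matrix.toEuclideanLin M)).le_opNorm (WithLp.toLp 2 v)

theorem opNorm_le {M : Matrix Y X ℂ} {c : ℝ} (hc : 0 ≤ c)
    (h : ∀ v : X → ℂ, ‖(WithLp.toLp 2 (M *ᵥ v) : EuclideanSpace ℂ Y)‖ ≤
      c * ‖(WithLp.toLp 2 v : EuclideanSpace ℂ X)‖) : opNorm M ≤ c :=
  ContinuousLinearMap.opNorm_le_bound _ hc fun v => h v.ofLp

theorem sum_sq_mulVec_le (M : Matrix Y X ℂ) (v : X → ℂ) :
    ∑ y, ‖(M *ᵥ v) y‖ ^ 2 ≤ opNorm M ^ 2 * ∑ x, ‖v x‖ ^ 2 := by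
  have h := pow_le_pow_left₀ (norm_nonneg _) (norm_mulVec_le M v) 2
  rwa [mul_pow, EuclideanSpace.norm_sq_eq, EuclideanSpace.norm_sq_eq] at h

theorem opNorm_le_of_sum_sq {M : Matrix Y X ℂ} {c : ℝ} (hc : 0 ≤ c)
    (h : ∀ v : X → ℂ, ∑ y, ‖(M *ᵥ v) y‖ ^ 2 ≤ c ^ 2 * ∑ x, ‖v x‖ ^ 2) : opNorm M ≤ c := by
  refine opNorm_le hc fun v => ?_
  rw [← pow_le_pow_iff_left₀ (norm_nonneg _) (by positivity) two_ne_zero, mul_pow,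
    EuclideanSpace.norm_sq_eq, EuclideanSpace.norm_sq_eq]
  exact h v

theorem opNorm_smul (c : ℂ) (M : Matrix Y X ℂ) : opNorm (c • M) = ‖c‖ * opNorm M := by
  simp only [opNorm, map_smul, norm_smul]

theorem opNorm_sum_le {ι : Type} (s : Finset ι) (M : ι → Matrix Y X ℂ) :
    opNorm (∑ i ∈ s, M i) ≤ ∑ i ∈ s, opNorm (M i) := by
  simp only [opNorm, map_sum]
  exact norm_sum_le _ _

theorem opNorm_eq_zero {M : Matrix Y X ℂ} : opNorm M = 0 ↔ M = 0 := by
  simp [opNorm]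

theorem continuous_opNorm : Continuous (opNorm : Matrix Y X ℂ → ℝ) := by
  have h : Continuous (((LinearMap.toContinuousLinearMap
      (𝕜 := ℂ) (E := EuclideanSpace ℂ X) (F' := EuclideanSpace ℂ Y)).toLinearMap ∘ₗ
      (Matrix.toEuclideanLin (𝕜 := ℂ) (m := Y) (n := X)).toLinearMap)) :=
    LinearMap.continuous_of_finiteDimensional _
  exact h.norm

open scoped ComplexOrder in
theorem posSemidef_one_sub_of_opNorm_le_one {M : Matrix Y X ℂ} (h : opNorm M ≤ 1) :
    (1 - Mᴴ * M).PosSemidef := by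
  refine Matrix.PosSemidef.of_dotProduct_mulVec_nonneg
    (Matrix.isHermitian_one.sub (Matrix.isHermitian_conjTranspose_mul_self M)) fun v => ?_
  have h1 : ∀ {Z : Type} [Fintype Z] (w : Z → ℂ),
      star w ⬝ᵥ w = ((∑ z, ‖w z‖ ^ 2 : ℝ) : ℂ) := fun w => by
    simp [dotProduct, Complex.conj_mul']
  have h2 : star v ⬝ᵥ ((1 - Mᴴ * M) *ᵥ v) =
      ((∑ x, ‖v x‖ ^ 2 - ∑ y, ‖(M *ᵥ v) y‖ ^ 2 : ℝ) : ℂ) := by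
    rw [Matrix.sub_mulVec, Matrix.one_mulVec, dotProduct_sub, h1, ← Matrix.mulVec_mulVec,
      Matrix.dotProduct_mulVec, ← Matrix.star_mulVec, h1]
    push_cast; rfl
  rw [h2]
  have h3 := sum_sq_mulVec_le M v
  have h4 : opNorm M ^ 2 ≤ 1 := pow_le_one₀ (opNorm_nonneg M) h
  have h5 : 0 ≤ ∑ x, ‖v x‖ ^ 2 := by positivity
  exact_mod_cast sub_nonneg.2 (h3.trans (by nlinarith))

/-- Apply `N` along the second index and then `M` along the first, bounding sums of squares slice by
slice. The bijections are arbitrary so that the lemma serves both for splitting off one tensor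
factor and for separating two groups of copies. -/
theorem opNorm_tensor_le (f : X ≃ X₁ × X₂) (g : Y ≃ Y₁ × Y₂) (M : Matrix Y₁ X₁ ℂ)
    (N : Matrix Y₂ X₂ ℂ) :
    opNorm (Matrix.of fun y x => M (g y).1 (f x).1 * N (g y).2 (f x).2) ≤
      opNorm M * opNorm N := by
  refine opNorm_le_of_sum_sq (mul_nonneg (opNorm_nonneg _) (opNorm_nonneg _)) fun v => ?_
  set u : X₁ → X₂ → ℂ := fun x₁ x₂ => v (f.symm (x₁, x₂)) with hu
  have hv : ∑ x, ‖v x‖ ^ 2 = ∑ x₁, ∑ x₂, ‖u x₁ x₂‖ ^ 2 := by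
    rw [← Fintype.sum_prod_type']
    exact Fintype.sum_equiv f _ _ fun x => by simp [hu]
  have hK : ∑ y, ‖((Matrix.of fun y x => M (g y).1 (f x).1 * N (g y).2 (f x).2) *ᵥ v) y‖ ^ 2 =
      ∑ y₂, ∑ y₁, ‖(M *ᵥ fun x₁ => (N *ᵥ u x₁) y₂) y₁‖ ^ 2 := by
    rw [Finset.sum_comm, ← Fintype.sum_prod_type']
    refine Fintype.sum_equiv g _ _ fun y => ?_
    congr 2
    simp only [Matrix.mulVec, dotProduct, Matrix.of_apply, Finset.mul_sum]
    rw [← Fintype.sum_prod_type']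
    exact Fintype.sum_equiv f _ _ fun x => by simp [hu, mul_assoc]
  rw [hK, hv]
  calc ∑ y₂, ∑ y₁, ‖(M *ᵥ fun x₁ => (N *ᵥ u x₁) y₂) y₁‖ ^ 2
      ≤ ∑ y₂, opNorm M ^ 2 * ∑ x₁, ‖(N *ᵥ u x₁) y₂‖ ^ 2 :=
        Finset.sum_le_sum fun y₂ _ => sum_sq_mulVec_le M _
    _ = opNorm M ^ 2 * ∑ x₁, ∑ y₂, ‖(N *ᵥ u x₁) y₂‖ ^ 2 := by
        rw [← Finset.mul_sum, Finset.sum_comm]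
    _ ≤ opNorm M ^ 2 * ∑ x₁, opNorm N ^ 2 * ∑ x₂, ‖u x₁ x₂‖ ^ 2 := by
        gcongr with x₁
        exact sum_sq_mulVec_le N _
    _ = (opNorm M * opNorm N) ^ 2 * ∑ x₁, ∑ x₂, ‖u x₁ x₂‖ ^ 2 := by
        rw [← Finset.mul_sum]; ring

theorem opNorm_row_le (ρ : X → ℂ) :
    opNorm (Matrix.of fun (_ : Unit) x => ρ x) ≤ √(∑ x, ‖ρ x‖ ^ 2) := by
  refine opNorm_le_of_sum_sq (Real.sqrt_nonneg _) fun v => ?_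
  rw [Real.sq_sqrt (by positivity)]
  simp only [Finset.univ_unique, Finset.sum_singleton, Matrix.mulVec, dotProduct, Matrix.of_apply]
  calc ‖∑ x, ρ x * v x‖ ^ 2 ≤ (∑ x, ‖ρ x‖ * ‖v x‖) ^ 2 := by
        gcongr
        exact (norm_sum_le _ _).trans_eq (by simp)
    _ ≤ _ := Finset.sum_mul_sq_le_sq_mul_sq _ _ _

theorem opNorm_tensor_row_le (f : X ≃ X₁ × X₂) (M : Matrix Y X₁ ℂ) (ρ : X₂ → ℂ) :
    opNorm (Matrix.of fun y x => M y (f x).1 * ρ (f x).2) ≤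
      opNorm M * √(∑ x, ‖ρ x‖ ^ 2) :=
  (opNorm_tensor_le f (Equiv.prodPUnit Y).symm M (Matrix.of fun (_ : Unit) x => ρ x)).trans
    (mul_le_mul_of_nonneg_left (opNorm_row_le ρ) (opNorm_nonneg _))

theorem exists_norm_mulVec_eq_opNorm [Nonempty X] (M : Matrix Y X ℂ) :
    ∃ v : X → ℂ, ∑ x, ‖v x‖ ^ 2 = 1 ∧ ∑ y, ‖(M *ᵥ v) y‖ ^ 2 = opNorm M ^ 2 := by
  set T := LinearMap.toContinuousLinearMap (Matrix.toEuclideanLin M) with hT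
  obtain ⟨v, hv, hmax⟩ := (isCompact_sphere (0 : EuclideanSpace ℂ X) 1).exists_isMaxOn
    (NormedSpace.sphere_nonempty.2 zero_le_one) T.continuous.norm.continuousOn
  rw [mem_sphere_zero_iff_norm] at hv
  have h1 : opNorm M = ‖T v‖ := le_antisymm
    (T.opNorm_le_of_unit_norm (norm_nonneg _) fun x hx => hmax (by simpa using hx))
    ((T.le_opNorm v).trans_eq (by rw [hv, mul_one]; rfl))
  refine ⟨v.ofLp, ?_, ?_⟩
  · rw [← EuclideanSpace.norm_sq_eq, hv, one_pow]
  · rw [h1, EuclideanSpace.norm_sq_eq]; rfl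

theorem norm_apply_le_opNorm (M : Matrix Y X ℂ) (y : Y) (x : X) : ‖M y x‖ ≤ opNorm M := by
  have h := sum_sq_mulVec_le M (Pi.single x 1)
  have h1 : ∑ x', ‖(Pi.single x 1 : X → ℂ) x'‖ ^ 2 = 1 := by
    rw [Finset.sum_eq_single x] <;> simp +contextual
  rw [h1, mul_one] at h
  have h2 := (Finset.single_le_sum (f := fun y => ‖(M *ᵥ Pi.single x 1) y‖ ^ 2)
    (fun _ _ => by positivity) (Finset.mem_univ y)).trans h
  simpa using (pow_le_pow_iff_left₀ (norm_nonneg _) (opNorm_nonneg M) two_ne_zero).1 h2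

end OpNorm

theorem kron_mulVec_prod {k : ℕ} {I J : Fin k → Type} [∀ j, Fintype (I j)]
    (B : ∀ j, Matrix (J j) (I j) ℂ) (v : ∀ j, I j → ℂ) (x : ∀ j, J j) :
    (kron B *ᵥ fun y => ∏ j, v j (y j)) x = ∏ j, (B j *ᵥ v j) (x j) := by
  simp only [kron, Matrix.mulVec, dotProduct, ← Finset.prod_mul_distrib]
  rw [Finset.prod_univ_sum, Fintype.piFinset_univ]

theorem opNorm_kron_le {k : ℕ} {I J : Fin k → Type} [∀ j, Fintype (I j)] [∀ j, DecidableEq (I j)]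
    [∀ j, Fintype (J j)] (B : ∀ j, Matrix (J j) (I j) ℂ) :
    opNorm (kron B) ≤ ∏ j, opNorm (B j) := by
  induction k with
  | zero =>
    refine opNorm_le_of_sum_sq (by simp) fun v => ?_
    simp [kron, Matrix.mulVec, dotProduct]
  | succ k ih =>
    rw [Fin.prod_univ_succ]
    have h := opNorm_tensor_le (Fin.consEquiv I).symm (Fin.consEquiv J).symm (B 0)
      (kron fun j : Fin k => B j.succ)
    have h1 : kron B = Matrix.of fun y x =>
        B 0 ((Fin.consEquiv J).symm y).1 ((Fin.consEquiv I).symm x).1 *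
          kron (fun j : Fin k => B j.succ) ((Fin.consEquiv J).symm y).2
            ((Fin.consEquiv I).symm x).2 := by
      ext y x
      simp only [kron, Fin.prod_univ_succ, Matrix.of_apply]
      rfl
    rw [h1]
    exact h.trans (mul_le_mul_of_nonneg_left (ih _) (opNorm_nonneg _))

theorem sum_prod_norm_sq {k : ℕ} {I : Fin k → Type} [∀ j, Fintype (I j)] (v : ∀ j, I j → ℂ) :
    ∑ y : ∀ j, I j, ‖∏ j, v j (y j)‖ ^ 2 = ∏ j, ∑ i, ‖v j i‖ ^ 2 := by
  rw [Finset.prod_univ_sum, Fintype.piFinset_univ]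
  simp [Finset.prod_pow]

/-- The lower bound comes from a product of norm-attaining unit vectors. If some `I j` is empty
there are none, but then that factor has norm 0. -/
theorem opNorm_kron {k : ℕ} {I J : Fin k → Type} [∀ j, Fintype (I j)] [∀ j, DecidableEq (I j)]
    [∀ j, Fintype (J j)] (B : ∀ j, Matrix (J j) (I j) ℂ) :
    opNorm (kron B) = ∏ j, opNorm (B j) := by
  refine le_antisymm (opNorm_kron_le B) ?_
  by_cases hI : ∀ j, Nonempty (I j)
  · choose v hv1 hv using fun j => exists_norm_mulVec_eq_opNorm (B j)
    have h := sum_sq_mulVec_le (kron B) fun y => ∏ j, v j (y j)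
    rw [sum_prod_norm_sq] at h
    simp_rw [kron_mulVec_prod, hv1] at h
    rw [sum_prod_norm_sq (fun j => B j *ᵥ v j)] at h
    simp_rw [hv] at h
    rw [Finset.prod_pow, Finset.prod_const_one, mul_one] at h
    exact (pow_le_pow_iff_left₀ (Finset.prod_nonneg fun j _ => opNorm_nonneg _)
      (opNorm_nonneg _) two_ne_zero).1 h
  · push Not at hI
    obtain ⟨j, hj⟩ := hI
    rw [Finset.prod_eq_zero (Finset.mem_univ j)]
    · exact opNorm_nonneg _
    · rw [opNorm_eq_zero]; ext y x; exact isEmptyElim x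

/-- A product of local operators mapping `ψ` to `φ` can be implemented by LOCC with a probability
determined by the norms of the local operators. -/
theorem LOCC.of_kron_mulVec {k : ℕ} (hk : 0 < k) {I J : Fin k → Type} [∀ j, Fintype (I j)]
    [∀ j, DecidableEq (I j)] [∀ j, Fintype (J j)] [∀ j, DecidableEq (J j)]
    {ψ : Tensor I} {φ : Tensor J} {B : ∀ j, Matrix (J j) (I j) ℂ} {β : Fin k → ℝ}
    (hβ : ∀ j, 0 < β j) (hB : ∀ j, opNorm (B j) ≤ β j) (h : kron B *ᵥ ψ = φ) :
    LOCC φ ψ ((∏ j, β j)⁻¹ ^ 2) := by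
  have h1 : kron (fun j => ((β j)⁻¹ : ℂ) • B j) *ᵥ ψ = (((∏ j, β j)⁻¹ : ℝ) : ℂ) • φ := by
    rw [← h, ← Matrix.smul_mulVec]
    congr 1
    ext x y
    simp [kron, Finset.prod_mul_distrib]
  have h2 := LOCC.of_contraction hk (fun j => posSemidef_one_sub_of_opNorm_le_one ?_) h1
  · simpa [abs_of_nonneg, Finset.prod_nonneg, (hβ _).le] using h2
  · rw [opNorm_smul, norm_inv, Complex.norm_real, Real.norm_of_nonneg (hβ j).le, inv_mul_le_iff₀ (hβ j),
      mul_one]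
    exact hB j

end

noncomputable section

/-! ### Blocks of correlated parties and extraction of GHZ states -/

section Blocks

variable {k : ℕ} {I J : Fin k → Type} {Q : Type}

/-- Splitting a multi-index according to a labelling of the parties. -/
def blockEquiv (I : Fin k → Type) (c : Fin k → Q) :
    (∀ j, I j) ≃ ∀ b, ∀ j : {j // c j = b}, I j where
  toFun x _ j := x j
  invFun p j := p (c j) ⟨j, rfl⟩
  left_inv _ := rfl
  right_inv p := by
    funext b ⟨j, hj⟩
    subst hj
    rfl

theorem sum_prod_block [∀ j, Fintype (I j)] [Fintype Q] [DecidableEq Q] {R : Type}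
    [CommSemiring R] (c : Fin k → Q) (f : ∀ b, (∀ j : {j // c j = b}, I j) → R) :
    ∑ y : ∀ j, I j, ∏ b, f b (fun j => y j) = ∏ b, ∑ y, f b y := by
  rw [Finset.prod_univ_sum, Fintype.piFinset_univ]
  exact Fintype.sum_equiv (blockEquiv I c) _ _ fun y => rfl

theorem kron_mulVec_block [∀ j, Fintype (I j)] [Fintype Q] [DecidableEq Q] {R : Type}
    [CommSemiring R] (c : Fin k → Q) (B : ∀ j, Matrix (J j) (I j) R)
    (f : ∀ b, (∀ j : {j // c j = b}, I j) → R) (x : ∀ j, J j) :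
    (kron B *ᵥ fun y => ∏ b, f b (fun j => y j)) x =
      ∏ b, ∑ y : ∀ j : {j // c j = b}, I j, (∏ j : {j // c j = b}, B j (x j) (y j)) * f b y := by
  rw [← sum_prod_block]
  simp only [Matrix.mulVec, dotProduct, kron]
  refine Finset.sum_congr rfl fun y _ => ?_
  rw [Finset.prod_mul_distrib, ← Fintype.prod_fiberwise c]

/-- Vanishing of the 2×2 minors across blocks means that the ratio by which `g` changes when
coordinate `i` is set to `a` is insensitive to any single coordinate outside the block of `i`.
Changing those coordinates one at a time shows that it depends on the block of `i` only. -/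
theorem mul_update_eq_of_agree {g : Tensor I} (hg : ∀ x, g x ≠ 0) (c : Fin k → Q)
    (H : ∀ i l, c i ≠ c l → ∀ (x : ∀ j, I j) (a : I i) (b : I l),
      g x * g (Function.update (Function.update x i a) l b) =
        g (Function.update x i a) * g (Function.update x l b))
    (i : Fin k) (a : I i) (x x' : ∀ j, I j) (hx : ∀ j, c j = c i → x j = x' j) :
    g (Function.update x' i a) * g x = g (Function.update x i a) * g x' := by
  classical
  have key : ∀ S : Finset (Fin k), (∀ l ∈ S, c l ≠ c i) →
      g (Function.update (S.piecewise x' x) i a) * g x =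
        g (Function.update x i a) * g (S.piecewise x' x) := by
    intro S
    induction S using Finset.induction_on with
    | empty => intro _; simp
    | insert l S _ ih =>
      intro hS
      have hl : c i ≠ c l := (hS l (by simp)).symm
      have h1 := ih fun m hm => hS m (by simp [hm])
      have h2 := H i l hl (S.piecewise x' x) a (x' l)
      rw [Finset.piecewise_insert, Function.update_comm (fun h => hl (by rw [h]))]
      apply mul_left_cancel₀ (hg (S.piecewise x' x))
      linear_combination g x * h2 + g (Function.update (S.piecewise x' x) l (x' l)) * h1
  have h := key (Finset.univ.filter fun l => c l ≠ c i) (by simp)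
  have h2 : (Finset.univ.filter fun l => c l ≠ c i).piecewise x' x = x' := by
    funext j
    by_cases hj : c j = c i <;> simp [Finset.piecewise, hj, hx]
  rwa [h2] at h

/-- Move from a reference point `x₀` to `x` one coordinate at a time. By `mul_update_eq_of_agree`
each ratio met on the way is determined inside one block and can be credited to that block. -/
theorem exists_block_factors [Fintype Q] [DecidableEq Q] (hk : 0 < k) {g : Tensor I}
    (hg : ∀ x, g x ≠ 0) (c : Fin k → Q)
    (H : ∀ i l, c i ≠ c l → ∀ (x : ∀ j, I j) (a : I i) (b : I l),
      g x * g (Function.update (Function.update x i a) l b) =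
        g (Function.update x i a) * g (Function.update x l b)) [∀ j, Nonempty (I j)] :
    ∃ f : ∀ b, (∀ j : {j // c j = b}, I j) → ℂ, ∀ x, g x = ∏ b, f b (fun j => x j) := by
  have x₀ : ∀ j, I j := fun j => Classical.arbitrary _
  have key : ∀ (x : ∀ j, I j) (S : Finset (Fin k)), g (S.piecewise x x₀) =
      g x₀ * ∏ b, (g ((S.filter fun j => c j = b).piecewise x x₀) / g x₀) := by
    intro x S
    induction S using Finset.induction_on with
    | empty =>
      have h : ∀ b, g ((Finset.filter (fun j => c j = b) ∅).piecewise x x₀) / g x₀ = 1 := fun b => by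
        rw [Finset.filter_empty, Finset.piecewise_empty, div_self (hg x₀)]
      rw [Finset.prod_congr rfl fun b _ => h b, Finset.prod_const_one, mul_one,
        Finset.piecewise_empty]
    | insert i S hi ih =>
      set r := g (Function.update (S.piecewise x x₀) i (x i)) / g (S.piecewise x x₀) with hr
      have h1 : ∀ b, g (((insert i S).filter fun j => c j = b).piecewise x x₀) / g x₀ =
          g ((S.filter fun j => c j = b).piecewise x x₀) / g x₀ * if c i = b then r else 1 := by
        intro b
        by_cases hb : c i = b
        · rw [Finset.filter_insert, if_pos hb, if_pos hb, Finset.piecewise_insert, hr]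
          have h2 := mul_update_eq_of_agree hg c H i (x i) (S.piecewise x x₀)
            ((S.filter fun j => c j = b).piecewise x x₀) (by
              intro j hj
              simp [Finset.piecewise, hj, hb])
          field_simp [hg]
          linear_combination h2
        · rw [Finset.filter_insert, if_neg hb, if_neg hb, mul_one]
      simp_rw [h1]
      rw [Finset.prod_mul_distrib, Finset.prod_ite_eq, if_pos (Finset.mem_univ _), ← mul_assoc, ← ih,
        hr, mul_div_cancel₀ _ (hg _), Finset.piecewise_insert]
  -- The leftover constant `g x₀` is assigned to the block of party `0`.
  refine ⟨fun b y => (g (fun j => if h : c j = b then y ⟨j, h⟩ else x₀ j) / g x₀) *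
    if c ⟨0, hk⟩ = b then g x₀ else 1, fun x => ?_⟩
  rw [Finset.prod_mul_distrib, Finset.prod_ite_eq, if_pos (Finset.mem_univ _)]
  have h := key x Finset.univ
  rw [Finset.piecewise_univ] at h
  rw [h, mul_comm]
  congr 1
  refine Finset.prod_congr rfl fun b _ => ?_
  congr 2
  funext j
  by_cases hj : c j = b <;> simp [Finset.piecewise, hj]

theorem exists_eval_ne_zero {σ ι : Type} [Fintype ι] (p : ι → MvPolynomial σ ℂ)
    (hp : ∀ i, p i ≠ 0) : ∃ v : σ → ℂ, ∀ i, MvPolynomial.eval v (p i) ≠ 0 := by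
  have h : ∏ i, p i ≠ 0 := Finset.prod_ne_zero_iff.2 fun i _ => hp i
  by_contra! H
  refine h (MvPolynomial.funext fun v => ?_)
  obtain ⟨i, hi⟩ := H v
  rw [map_prod, map_zero]
  exact Finset.prod_eq_zero (Finset.mem_univ i) hi

/-- In generic local bases, all coordinates of a nonzero tensor are nonzero. -/
theorem exists_generic_bases [∀ j, Fintype (I j)] [∀ j, DecidableEq (I j)] {ψ : Tensor I}
    (hψ : ψ ≠ 0) : ∃ G : ∀ j, Matrix (I j) (I j) ℂ, (∀ j, IsUnit (G j).det) ∧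
      ∀ x, (kron G *ᵥ ψ) x ≠ 0 := by
  obtain ⟨y₀, hy₀⟩ := Function.ne_iff.1 hψ
  let σ := Σ j, I j × I j
  let G : ∀ j, Matrix (I j) (I j) (MvPolynomial σ ℂ) :=
    fun j => Matrix.of fun a b => MvPolynomial.X ⟨j, a, b⟩
  have hdet : ∀ (v : σ → ℂ) j, MvPolynomial.eval v (G j).det =
      (Matrix.of fun a b => v ⟨j, a, b⟩ : Matrix (I j) (I j) ℂ).det := fun v j => by
    rw [RingHom.map_det]
    congr 1
    ext a b
    simp [G]
  have hent : ∀ (v : σ → ℂ) x, MvPolynomial.eval v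
      ((kron G *ᵥ fun y => MvPolynomial.C (ψ y)) x) =
        (kron (fun j => (Matrix.of fun a b => v ⟨j, a, b⟩ : Matrix (I j) (I j) ℂ)) *ᵥ ψ) x :=
    fun v x => by
      simp [Matrix.mulVec, dotProduct, kron, G, map_sum, map_prod]
  obtain ⟨v, hv⟩ := exists_eval_ne_zero (σ := σ) (Sum.elim (fun j => (G j).det)
    fun x => (kron G *ᵥ fun y => MvPolynomial.C (ψ y)) x) (by
      rintro (j | x) h
      -- The determinant is a nonzero polynomial because it equals 1 at the identity matrix.
      · have := hdet (fun s => if s.2.1 = s.2.2 then 1 else 0) j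
        simp only [Sum.elim_inl] at h
        rw [h, map_zero] at this
        have h1 : (Matrix.of fun a b => if a = b then 1 else 0 : Matrix (I j) (I j) ℂ) = 1 := by
          ext a b; simp [Matrix.one_apply]
        rw [h1, Matrix.det_one] at this
        exact zero_ne_one this
      -- With all rows of the `j`-th matrix equal to the basis covector of `y₀ j`, every coordinate
      -- evaluates to `ψ y₀ ≠ 0`.
      · have := hent (fun s => if s.2.2 = y₀ s.1 then 1 else 0) x
        simp only [Sum.elim_inr] at h
        rw [h, map_zero] at this
        simp only [Matrix.mulVec, dotProduct, kron, Matrix.of_apply] at this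
        rw [Finset.sum_eq_single y₀] at this
        · simp at this; exact hy₀ this.symm
        · intro y _ hy
          obtain ⟨j, hj⟩ := Function.ne_iff.1 hy
          rw [Finset.prod_eq_zero (Finset.mem_univ j) (by simp [hj]), zero_mul]
        · simp)
  refine ⟨fun j => Matrix.of fun a b => v ⟨j, a, b⟩, fun j => ?_, fun x => ?_⟩
  · rw [← hdet]; exact (hv (Sum.inl j)).isUnit
  · rw [← hent]; exact hv (Sum.inr x)

section Pairs

variable [∀ j, Fintype (I j)] [∀ j, DecidableEq (I j)] {S : Type}

theorem kron_select_mulVec {S : Fin k → Type} (sel : ∀ j, S j → I j)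
    (t : Fin k → ℂ) (w : Tensor I) (u : ∀ j, S j) :
    (kron (fun j => (Matrix.of fun s y => if y = sel j s then t j else 0 :
      Matrix (S j) (I j) ℂ)) *ᵥ w)
      u = (∏ j, t j) * w fun j => sel j (u j) := by
  simp only [Matrix.mulVec, dotProduct, kron, Matrix.of_apply]
  rw [Finset.sum_eq_single fun j => sel j (u j)]
  · simp
  · intro y _ hy
    obtain ⟨j, hj⟩ := Function.ne_iff.1 hy
    rw [Finset.prod_eq_zero (Finset.mem_univ j) (by simp [hj]), zero_mul]
  · simp

theorem kron_single_mulVec [Fintype S] [DecidableEq S] (i : Fin k) (M : Matrix S S ℂ)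
    (w : (Fin k → S) → ℂ) (u : Fin k → S) :
    (kron (fun j => if j = i then M else 1) *ᵥ w) u =
      ∑ s, M (u i) s * w (Function.update u i s) := by
  simp only [Matrix.mulVec, dotProduct, kron]
  symm
  refine Fintype.sum_of_injective (fun s => Function.update u i s)
    (Function.update_injective u i) _ _ (fun y hy => ?_) fun s => ?_
  · have : ∃ j, j ≠ i ∧ u j ≠ y j := by
      by_contra! H
      refine hy ⟨y i, ?_⟩
      funext j
      by_cases hj : j = i
      · subst hj; simp
      · simp [hj, H j hj]
    obtain ⟨j, hj, hne⟩ := this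
    rw [Finset.prod_eq_zero (Finset.mem_univ j) (by simp [hj, hne]), zero_mul]
  · rw [Finset.prod_eq_single i]
    · simp
    · intro j _ hj
      rw [if_neg hj, Function.update_of_ne hj, Matrix.one_apply_eq]
    · simp

/-- If coordinates `i` and `l` of `w` are correlated, then `w` can be projected to an entangled
pair of the parties `i` and `l`. -/
theorem exists_pair_of_minor_ne_zero {w : Tensor I} {i l : Fin k} (hil : i ≠ l) {x : ∀ j, I j}
    {a : I i} {b : I l}
    (h : w x * w (Function.update (Function.update x i a) l b) ≠
      w (Function.update x i a) * w (Function.update x l b)) :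
    ∃ F : ∀ j, Matrix (Fin 2) (I j) ℂ, ∀ u, (kron F *ᵥ w) u = if u i = u l then 1 else 0 := by
  set x' := Function.update (Function.update x i a) l b with hx'
  -- Each party keeps two basis vectors. Since `x'` differs from `x` at most at `i` and `l`, what
  -- remains of `w` is the 2×2 matrix `N` in the bits of `i` and `l`; its determinant is the given
  -- minor, so party `i` can undo it by `N⁻¹`.
  let sel : ∀ j, Fin 2 → I j := fun j s => if s = 0 then x j else x' j
  let N : Matrix (Fin 2) (Fin 2) ℂ := Matrix.of fun s t =>
    w (Function.update (Function.update x i (sel i s)) l (sel l t))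
  have hN : IsUnit N.det := by
    rw [Matrix.det_fin_two, isUnit_iff_ne_zero, sub_ne_zero]
    have h1 : Function.update (Function.update x i a) l (x l) = Function.update x i a := by
      rw [Function.update_eq_self_iff, Function.update_of_ne hil.symm]
    simpa [N, sel, hx', hil, h1, mul_comm] using h
  let F₀ : ∀ j, Matrix (Fin 2) (I j) ℂ :=
    fun j => Matrix.of fun s y => if y = sel j s then 1 else 0
  refine ⟨fun j => (if j = i then N⁻¹ else 1) * F₀ j, fun u => ?_⟩
  rw [← kron_mul, ← Matrix.mulVec_mulVec, kron_single_mulVec]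
  have h1 : ∀ v : Fin k → Fin 2, (kron F₀ *ᵥ w) v = N (v i) (v l) := fun v => by
    rw [kron_select_mulVec sel (fun _ => 1) w v]
    simp only [Finset.prod_const_one, one_mul, N, Matrix.of_apply]
    congr 1
    funext j
    by_cases hl : j = l
    · subst hl; simp
    · by_cases hi : j = i
      · subst hi; simp [hl]
      · simp [hl, hi, sel, hx']
  simp only [h1, Function.update_self, Function.update_of_ne hil.symm]
  rw [← Matrix.mul_apply, Matrix.nonsing_inv_mul _ hN, Matrix.one_apply]

end Pairs

/-- Every nonzero tensor is a product over blocks of parties such that the parties of each block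
can extract a GHZ state from copies of the tensor. -/
theorem exists_block_decomposition [∀ j, Fintype (I j)] [∀ j, DecidableEq (I j)] (hk : 0 < k) {ψ : Tensor I}
    (hψ : ψ ≠ 0) : ∃ (Q : Type) (_ : Fintype Q) (_ : DecidableEq Q) (c : Fin k → Q)
      (f : ∀ b, (∀ j : {j // c j = b}, I j) → ℂ)
      (F : Fin k × Fin k → ∀ j, Matrix (Fin 2) (I j) ℂ),
      Function.Surjective c ∧ (∀ x, ψ x = ∏ b, f b (fun j => x j)) ∧
      ∀ u : Fin k → Fin 2, ∏ p, (kron (F p) *ᵥ ψ) u =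
        if ∀ i j, c i = c j → u i = u j then 1 else 0 := by
  classical
  obtain ⟨G, hG, hne⟩ := exists_generic_bases hψ
  set g := kron G *ᵥ ψ with hg
  have hI : ∀ j, Nonempty (I j) := fun j => by
    obtain ⟨y, -⟩ := Function.ne_iff.1 hψ
    exact ⟨y j⟩
  -- Parties are adjacent if some minor is nonzero; the blocks are the classes of the equivalence
  -- relation generated by `adj`. Minors between different blocks therefore vanish.
  let adj : Fin k → Fin k → Prop := fun i l => i ≠ l ∧ ∃ (x : ∀ j, I j) (a : I i) (b : I l),
    g x * g (Function.update (Function.update x i a) l b) ≠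
      g (Function.update x i a) * g (Function.update x l b)
  let c : Fin k → Quot adj := Quot.mk adj
  have hc : Function.Surjective c := Quot.mk_surjective
  let _ : Fintype (Quot adj) := Fintype.ofSurjective c hc
  obtain ⟨h, hh⟩ := exists_block_factors hk hne c (by
    intro i l hil x a b
    by_contra H
    exact hil (Quot.sound ⟨fun h => hil (by rw [h]), x, a, b, H⟩))
  -- Adjacent pairs yield an EPR-type correlation. For the other pairs one basis vector is projected
  -- out and rescaled to give the constant 1, so that every pair can be treated alike. Multiplied
  -- over all pairs, these correlations form the GHZ indicator of each block.
  have hF : ∀ p : Fin k × Fin k, ∃ F : ∀ j, Matrix (Fin 2) (I j) ℂ, ∀ u, (kron F *ᵥ g) u =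
      if adj p.1 p.2 → u p.1 = u p.2 then 1 else 0 := by
    rintro ⟨i, l⟩
    by_cases hil : adj i l
    · obtain ⟨hne, x, a, b, hm⟩ := hil
      obtain ⟨F, hF⟩ := exists_pair_of_minor_ne_zero hne hm
      refine ⟨F, fun u => ?_⟩
      rw [hF]
      have : adj i l := ⟨hne, x, a, b, hm⟩
      simp [this]
    · have x₀ : ∀ j, I j := fun j => Classical.arbitrary _
      refine ⟨_, fun u => (kron_select_mulVec (fun j _ => x₀ j)
        (fun j => if j = ⟨0, hk⟩ then (g x₀)⁻¹ else 1) g u).trans ?_⟩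
      simp [hil, hne]
  choose F hF using hF
  refine ⟨Quot adj, inferInstance, inferInstance, c, fun b y => ∑ z : ∀ j : {j // c j = b}, I j,
    (∏ j : {j // c j = b}, (G j)⁻¹ (y j) (z j)) * h b z, fun p j => F p j * G j, hc, fun x => ?_,
    fun u => ?_⟩
  · rw [← kron_mulVec_block c (fun j => (G j)⁻¹) h x]
    have h1 : (fun y => ∏ b, h b fun j => y j) = g := (funext hh).symm
    have h2 : kron (fun j => (G j)⁻¹ * G j) = (1 : Matrix (∀ j, I j) (∀ j, I j) ℂ) := by
      ext y z
      simp only [kron, Matrix.nonsing_inv_mul _ (hG _), Matrix.one_apply, funext_iff]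
      by_cases hyz : ∀ j, y j = z j
      · simp [hyz]
      · rw [if_neg hyz]
        push Not at hyz
        obtain ⟨j, hj⟩ := hyz
        exact Finset.prod_eq_zero (Finset.mem_univ j) (by simp [hj])
    rw [h1, hg, Matrix.mulVec_mulVec, kron_mul, h2, Matrix.one_mulVec]
  · simp_rw [← kron_mul, ← Matrix.mulVec_mulVec, ← hg, hF]
    rw [Finset.prod_ite_zero]
    simp only [Finset.mem_univ, true_imp_iff, Finset.prod_const_one]
    congr 1
    refine propext ⟨fun H i j hij => ?_, fun H p hp => H _ _ (Quot.sound hp)⟩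
    exact congrArg (Quot.lift u fun a b hab => H (a, b) hab) hij

end Blocks

end

/-! ### Splitting interpolation weights over blocks by duality -/

noncomputable section

open Polynomial in
/-- The weights of an interpolation formula at `0` for polynomials of degree `∑ b, D b` can be
replaced by weights for the degrees `D b` without increasing the product of the weighted norms
(up to a constant). -/
theorem exists_block_weights {Q N : Type} [Fintype Q] [Fintype N] {z w : N → ℂ} {d : ℕ}
    {D : Q → ℕ} (hD : ∑ b, D b ≤ d) {g : Q → N → ℝ} (hg : ∀ b i, 0 < g b i) {M : ℝ}
    (hw : ∀ f : ℂ[X], f.natDegree ≤ d → ∑ i, w i * f.eval (z i) = f.eval 0)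
    (hM : ∑ i, ‖w i‖ * ∏ b, g b i ≤ M) :
    ∃ w' : Q → N → ℂ,
      (∀ b (f : ℂ[X]), f.natDegree ≤ D b → ∑ i, w' b i * f.eval (z i) = f.eval 0) ∧
      ∏ b, ∑ i, ‖w' b i‖ * g b i ≤ 2 ^ Fintype.card Q * M := by
  classical
  have hDb : ∀ b, D b ≤ d := fun b =>
    (Finset.single_le_sum (fun _ _ => Nat.zero_le _) (Finset.mem_univ b)).trans hD
  -- Hahn–Banach duality: the least cost of weights for degree `D b` equals the supremum of `|f(0)|`
  -- over `f` of that degree with `|f(z i)| ≤ g b i`. The polynomial `f₀` is only near-extremal,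
  -- whence the factor 2.
  have key : ∀ b, ∃ (w' : N → ℂ) (f₀ : ℂ[X]),
      (∀ f : ℂ[X], f.natDegree ≤ D b → ∑ i, w' i * f.eval (z i) = f.eval 0) ∧
      f₀.natDegree ≤ D b ∧ (∀ i, ‖f₀.eval (z i)‖ ≤ g b i) ∧
      ∑ i, ‖w' i‖ * g b i ≤ 2 * ‖f₀.eval 0‖ := by
    intro b
    have hgc : ∀ i, (g b i : ℂ) ≠ 0 := fun i => by exact_mod_cast (hg b i).ne'
    -- Dividing by `g b i` turns the constraint on `f` into the unit ball of the sup norm, and the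
    -- dual norm into the weighted ℓ¹ cost. The given `w`, valid also for degree `D b ≤ d`, shows
    -- that evaluation at 0 is a functional of these values.
    let ev : ℂ[X] →ₗ[ℂ] (N → ℂ) := LinearMap.pi fun i => (g b i : ℂ)⁻¹ • leval (z i)
    have hev : ∀ f i, ev f i = (g b i : ℂ)⁻¹ * f.eval (z i) := fun f i => by simp [ev]
    let p : Submodule ℂ (N → ℂ) := (degreeLE ℂ (D b)).map ev
    let ℓ₀ : (N → ℂ) →L[ℂ] ℂ := LinearMap.toContinuousLinearMap
      (∑ i, (w i * g b i) • LinearMap.proj i)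
    have hℓ₀ : ∀ f : ℂ[X], f.natDegree ≤ D b → ℓ₀ (ev f) = f.eval 0 := fun f hf => by
      rw [← hw f (hf.trans (hDb b))]
      simp only [ℓ₀, LinearMap.coe_toContinuousLinearMap', LinearMap.sum_apply,
        LinearMap.smul_apply, LinearMap.proj_apply, smul_eq_mul, hev]
      refine Finset.sum_congr rfl fun i _ => ?_
      field_simp [hgc i]
    obtain ⟨L, hL, hLn⟩ := exists_extension_norm_eq p (ℓ₀.comp p.subtypeL)
    have hmem : ∀ f : ℂ[X], f.natDegree ≤ D b → ev f ∈ p := fun f hf =>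
      Submodule.mem_map_of_mem (mem_degreeLE.2 (natDegree_le_iff_degree_le.1 hf))
    have hLs : ∀ v, L v = ∑ i, v i * L (Pi.single i 1) := fun v => by
      conv_lhs => rw [← Finset.univ_sum_single v, map_sum]
      refine Finset.sum_congr rfl fun i _ => ?_
      rw [← smul_eq_mul, ← map_smul, ← Pi.single_smul, smul_eq_mul, mul_one]
    have hx : ∃ x : p, ‖x‖ ≤ 1 ∧ ‖L‖ ≤ 2 * ‖L x‖ := by
      rcases (norm_nonneg L).eq_or_lt with h | h
      · exact ⟨0, by simp, by simp [← h]⟩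
      · obtain ⟨x, hx, hlt⟩ := (ℓ₀.comp p.subtypeL).exists_lt_apply_of_lt_opNorm
          (r := ‖L‖ / 2) (by rw [← hLn]; linarith)
        refine ⟨x, hx.le, ?_⟩
        rw [hL]; linarith
    obtain ⟨⟨_, f₀, hf₀, rfl⟩, hx1, hx2⟩ := hx
    have hf₀ : f₀.natDegree ≤ D b := natDegree_le_iff_degree_le.2 (mem_degreeLE.1 hf₀)
    refine ⟨fun i => L (Pi.single i 1) * (g b i : ℂ)⁻¹, f₀, fun f hf => ?_, hf₀, fun i => ?_, ?_⟩
    · rw [← hℓ₀ f hf, ← show L (ev f) = ℓ₀ (ev f) from hL ⟨ev f, hmem f hf⟩, hLs]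
      refine Finset.sum_congr rfl fun i _ => ?_
      rw [hev]; ring
    · have h1 : ‖ev f₀ i‖ ≤ 1 := (norm_le_pi_norm (ev f₀) i).trans hx1
      rwa [hev, norm_mul, norm_inv, Complex.norm_real, Real.norm_of_nonneg (hg b i).le,
        inv_mul_le_iff₀ (hg b i), mul_one] at h1
    · have h1 : ∑ i, ‖L (Pi.single i 1)‖ ≤ ‖L‖ := by
        -- Testing `L` on the vector of conjugate phases shows that its ℓ¹ norm is at most the dual
        -- norm. A vanishing coefficient gives the harmless entry `0 / 0 = 0`.
        have h2 := L.le_opNorm fun i => (starRingEnd ℂ) (L (Pi.single i 1)) / ‖L (Pi.single i 1)‖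
        have h3 : ‖fun i => (starRingEnd ℂ) (L (Pi.single i 1)) / (‖L (Pi.single i 1)‖ : ℂ)‖ ≤ 1 :=
          (pi_norm_le_iff_of_nonneg zero_le_one).2 fun i => by
            simp [div_self_le_one]
        rw [hLs] at h2
        have h4 : ∑ i, (starRingEnd ℂ) (L (Pi.single i 1)) / (‖L (Pi.single i 1)‖ : ℂ) *
            L (Pi.single i 1) = ((∑ i, ‖L (Pi.single i 1)‖ : ℝ) : ℂ) := by
          push_cast
          refine Finset.sum_congr rfl fun i _ => ?_
          rw [div_mul_eq_mul_div, Complex.conj_mul', sq, mul_self_div_self]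
        rw [h4, Complex.norm_real, Real.norm_of_nonneg (by positivity)] at h2
        exact h2.trans (mul_le_of_le_one_right (norm_nonneg _) h3)
      have h5 : L (ev f₀) = f₀.eval 0 := (hL ⟨ev f₀, hmem f₀ hf₀⟩).trans (hℓ₀ f₀ hf₀)
      rw [← h5]
      refine (Finset.sum_le_sum fun i _ => ?_).trans (h1.trans hx2)
      rw [norm_mul, norm_inv, Complex.norm_real, Real.norm_of_nonneg (hg b i).le,
        inv_mul_cancel_right₀ (hg b i).ne']
  choose w' f hw' hf hfg hs using key
  refine ⟨w', hw', ?_⟩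
  -- The product of the near-extremal polynomials has degree at most `d`, so the original weights
  -- `w` apply to it and bound its value at 0 by `M`.
  calc ∏ b, ∑ i, ‖w' b i‖ * g b i ≤ ∏ b, (2 * ‖(f b).eval 0‖) :=
        Finset.prod_le_prod (fun b _ => Finset.sum_nonneg fun i _ =>
          mul_nonneg (norm_nonneg _) (hg b i).le) fun b _ => hs b
    _ = 2 ^ Fintype.card Q * ‖(∏ b, f b).eval 0‖ := by
        rw [Finset.prod_mul_distrib, Finset.prod_const, Finset.card_univ, eval_prod, norm_prod]
    _ ≤ 2 ^ Fintype.card Q * M := by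
        gcongr
        rw [← hw _ ((natDegree_prod_le _ _).trans ((Finset.sum_le_sum fun b _ => hf b).trans hD))]
        refine (norm_sum_le _ _).trans ((Finset.sum_le_sum fun i _ => ?_).trans hM)
        rw [norm_mul, eval_prod, norm_prod]
        gcongr with b _
        exact hfg b i

end

/-! ### Factoring a degeneration over blocks -/

noncomputable section

open Polynomial in
theorem exists_eq_X_pow_mul {ι : Type} (q : ι → ℂ[X]) {i₀ : ι} (h : q i₀ ≠ 0) :
    ∃ (r : ℕ) (p : ι → ℂ[X]), (∀ i, q i = X ^ r * p i) ∧ ∃ i, (p i).coeff 0 ≠ 0 := by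
  classical
  have hex : ∃ r, ¬ ∀ i, X ^ r ∣ q i := by
    refine ⟨(q i₀).natDegree + 1, fun H => ?_⟩
    have := natDegree_le_of_dvd (H i₀) h
    rw [natDegree_X_pow] at this
    omega
  have hr := Nat.find_spec hex
  have hmin := @Nat.find_min _ _ hex
  obtain ⟨r, hrr⟩ : ∃ r, Nat.find hex = r + 1 := Nat.exists_eq_succ_of_ne_zero fun h0 => by
    rw [h0] at hr; simp at hr
  rw [hrr] at hr hmin
  have h1 := not_not.1 (hmin r.lt_succ_self)
  choose p hp using h1
  push Not at hr
  obtain ⟨i, hi⟩ := hr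
  refine ⟨r, p, hp, i, fun h0 => hi ?_⟩
  obtain ⟨s, hs⟩ := X_dvd_iff.2 h0
  exact ⟨s, by rw [hp, hs, pow_succ, mul_assoc]⟩

open Polynomial in
theorem exists_natDegree_max {ι : Type} [Finite ι] (p : ι → ℂ[X]) {i₀ : ι} (h : p i₀ ≠ 0) :
    ∃ i, p i ≠ 0 ∧ ∀ i', (p i').natDegree ≤ (p i).natDegree := by
  obtain ⟨i, hi, hmax⟩ := Set.exists_max_image {i | p i ≠ 0} (fun i => (p i).natDegree)
    (Set.toFinite _) ⟨i₀, h⟩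
  refine ⟨i, hi, fun i' => ?_⟩
  by_cases h0 : p i' = 0
  · simp [h0]
  · exact hmax i' h0

variable {k : ℕ} {I J : Fin k → Type} [∀ j, Fintype (I j)] [∀ j, Fintype (J j)]

open Polynomial in
/-- A degeneration of a product tensor is a product of degenerations, up to powers of `z`. -/
theorem IsDegeneration.exists_blocks {Q : Type} [Fintype Q] [DecidableEq Q] {c : Fin k → Q}
    {f : ∀ b, (∀ j : {j // c j = b}, I j) → ℂ} {ψ : Tensor I} (hf : ∀ x, ψ x = ∏ b, f b fun j => x j)
    {φ : Tensor J} (hφ : φ ≠ 0) {A : ∀ j, Matrix (J j) (I j) ℂ[T;T⁻¹]} {e : ℕ}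
    (hA : IsDegeneration ψ φ A e) :
    ∃ (P : ∀ b, (∀ j : {j // c j = b}, J j) → ℂ[X]) (m : Q → ℤ) (D : Q → ℕ),
      (∀ b x, (P b x).natDegree ≤ D b) ∧ ∑ b, D b ≤ e ∧ ∑ b, m b = 0 ∧
      (∀ x : ∀ j, J j, ∏ b, (P b fun j => x j).eval 0 = φ x) ∧
      ∀ b x (z : ℂˣ), ∑ y, (∏ j : {j // c j = b},
        (A j).map (LaurentPolynomial.eval₂ (RingHom.id ℂ) z) (x j) (y j)) * f b y =
          (z : ℂ) ^ m b * (P b x).eval (z : ℂ) := by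
  obtain ⟨P, hPdeg, hP0, hP⟩ := hA
  let V : ∀ b, (∀ j : {j // c j = b}, J j) → ℂ[T;T⁻¹] := fun b x =>
    ∑ y : ∀ j : {j // c j = b}, I j, (∏ j : {j // c j = b}, A j (x j) (y j)) *
      LaurentPolynomial.C (f b y)
  have hV : ∀ x : ∀ j, J j, ∏ b, V b (fun j => x j) = toLaurent (P x) := fun x => by
    rw [← congrFun hP x, ← kron_mulVec_block c A (fun b y => LaurentPolynomial.C (f b y)) x]
    congr 1
    funext y
    rw [hf, map_prod]
  have hN : ∃ N : ℕ, ∀ b x, ∃ q : ℂ[X], toLaurent q = V b x * LaurentPolynomial.T N := by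
    choose n q hq using fun s : Σ b, ∀ j : {j // c j = b}, J j => (V s.1 s.2).exists_T_pow
    refine ⟨∑ s, n s, fun b x => ?_⟩
    obtain ⟨t, ht⟩ := Nat.exists_eq_add_of_le
      (Finset.single_le_sum (f := n) (fun _ _ => Nat.zero_le _) (Finset.mem_univ ⟨b, x⟩))
    refine ⟨q ⟨b, x⟩ * X ^ t, ?_⟩
    rw [map_mul, hq, ht, toLaurent_X_pow, Nat.cast_add, LaurentPolynomial.T_add, mul_assoc]
  obtain ⟨N, hN⟩ := hN
  choose q hq using hN
  obtain ⟨x₁, hx₁⟩ := Function.ne_iff.1 hφ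
  have hPx₁ : P x₁ ≠ 0 := fun h => hx₁ (by rw [← hP0, h]; simp)
  have hprodq : ∀ x : ∀ j, J j, ∏ b, q b (fun j => x j) = P x * X ^ (N * Fintype.card Q) :=
    fun x => by
      apply toLaurent_injective
      rw [map_prod, map_mul, ← hV, toLaurent_X_pow]
      simp_rw [hq]
      rw [Finset.prod_mul_distrib, Finset.prod_const, Finset.card_univ, LaurentPolynomial.T_pow,
        Nat.cast_mul, mul_comm (N : ℤ)]
  have hq₁ : ∀ b, q b (fun j => x₁ j) ≠ 0 := fun b h => by
    have := hprodq x₁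
    rw [Finset.prod_eq_zero (Finset.mem_univ b) h] at this
    exact mul_ne_zero hPx₁ (pow_ne_zero _ X_ne_zero) this.symm
  choose r p hp x₀ hx₀ using fun b => exists_eq_X_pow_mul (q b) (hq₁ b)
  have hrel : ∀ x : ∀ j, J j, X ^ (∑ b, r b) * ∏ b, p b (fun j => x j) =
      X ^ (N * Fintype.card Q) * P x := fun x => by
    rw [mul_comm _ (P x), ← hprodq, ← Finset.prod_pow_eq_pow_sum, ← Finset.prod_mul_distrib]
    simp_rw [hp]
  have hblock : ∀ (y : ∀ b, ∀ j : {j // c j = b}, J j) (b : Q),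
      (fun j : {j // c j = b} => (blockEquiv J c).symm y j) = y b := fun y b =>
    congrFun ((blockEquiv J c).apply_symm_apply y) b
  -- The powers of `X` removed from the blocks must cancel the powers introduced to clear
  -- denominators. Too few would contradict the nonvanishing at 0 of the product of the entries at
  -- `x₀`; too many would make `φ x₁` vanish.
  have hr : ∑ b, r b = N * Fintype.card Q := by
    rcases lt_trichotomy (∑ b, r b) (N * Fintype.card Q) with h | h | h
    · obtain ⟨t, ht⟩ := Nat.exists_eq_add_of_lt h
      have h1 := hrel ((blockEquiv J c).symm x₀)
      rw [ht, add_assoc, pow_add, mul_assoc] at h1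
      have h2 := mul_left_cancel₀ (pow_ne_zero _ X_ne_zero) h1
      have h3 := congrArg (eval 0) h2
      simp_rw [hblock] at h3
      rw [eval_mul, eval_pow, eval_X, zero_pow (Nat.succ_ne_zero _), zero_mul, eval_prod] at h3
      refine absurd h3 (Finset.prod_ne_zero_iff.2 fun b _ => ?_)
      rw [← coeff_zero_eq_eval_zero]; exact hx₀ b
    · exact h
    · obtain ⟨t, ht⟩ := Nat.exists_eq_add_of_lt h
      have h1 := hrel x₁
      rw [ht, add_assoc, pow_add, mul_assoc] at h1
      have h2 := mul_left_cancel₀ (pow_ne_zero _ X_ne_zero) h1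
      refine absurd ?_ hx₁
      rw [← hP0, coeff_zero_eq_eval_zero, ← h2, eval_mul, eval_pow, eval_X,
        zero_pow (Nat.succ_ne_zero _), zero_mul]
      rfl
  have hprod : ∀ x : ∀ j, J j, ∏ b, p b (fun j => x j) = P x := fun x => by
    have h1 := hrel x
    rw [hr] at h1
    exact mul_left_cancel₀ (pow_ne_zero _ X_ne_zero) h1
  -- Entries of maximal degree in each block combine to a single entry of `P`, whose degree is the
  -- sum of these maxima. Hence the block degrees add up to at most `e`.
  choose y hy hmax using fun b => exists_natDegree_max (p b) (i₀ := x₀ b)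
    fun h => hx₀ b (by rw [h]; simp)
  refine ⟨p, fun b => r b - N, fun b => (p b (y b)).natDegree, hmax, ?_, ?_, fun x => ?_,
    fun b x z => ?_⟩
  · rw [← natDegree_prod _ _ fun b _ => hy b]
    refine le_trans (le_of_eq ?_) (hPdeg ((blockEquiv J c).symm y))
    rw [← hprod]
    simp_rw [hblock]
  · rw [Finset.sum_sub_distrib, ← Nat.cast_sum, hr]
    simp [mul_comm]
  · rw [← eval_prod, hprod, ← coeff_zero_eq_eval_zero, hP0]
  · have h1 := congrArg (LaurentPolynomial.eval₂ (RingHom.id ℂ) z) (hq b x)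
    have h2 : LaurentPolynomial.eval₂ (RingHom.id ℂ) z (V b x) = ∑ y, (∏ j : {j // c j = b},
        (A j).map (LaurentPolynomial.eval₂ (RingHom.id ℂ) z) (x j) (y j)) * f b y := by
      simp [V, map_sum, map_prod]
    have hz : (z : ℂ) ≠ 0 := z.ne_zero
    rw [← h2, zpow_sub₀ hz, div_mul_eq_mul_div, eq_div_iff (zpow_ne_zero _ hz)]
    rw [map_mul, LaurentPolynomial.eval₂_T, LaurentPolynomial.eval₂_toLaurent, hp] at h1
    simpa [eval₂_id] using h1.symm

end

/-! ### The interpolation protocol -/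

noncomputable section

theorem prod_zpow_sum {ι : Type} (s : Finset ι) {z : ℂ} (hz : z ≠ 0) (m : ι → ℤ) :
    ∏ b ∈ s, z ^ m b = z ^ ∑ b ∈ s, m b := by
  classical
  induction s using Finset.induction_on with
  | empty => simp
  | insert b s hb ih => rw [Finset.prod_insert hb, Finset.sum_insert hb, zpow_add₀ hz, ih]

/-- One root party `ρ b` per block carries the weight of the block, so each weight enters the
product over parties exactly once. -/
theorem prod_root {k : ℕ} {Q R : Type} [Fintype Q] [DecidableEq Q] [CommMonoid R] {c : Fin k → Q}
    {ρ : Q → Fin k} (hρ : ∀ b, c (ρ b) = b) (G : Q → R) :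
    ∏ j, (if j = ρ (c j) then G (c j) else 1) = ∏ b, G b := by
  rw [← Fintype.prod_fiberwise c]
  refine Finset.prod_congr rfl fun b _ => ?_
  rw [Finset.prod_eq_single ⟨ρ b, hρ b⟩]
  · simp [hρ]
  · rintro ⟨j, rfl⟩ _ hj
    exact if_neg fun h => hj (Subtype.ext h)
  · simp

section Power

variable {k : ℕ} {I J : Fin k → Type} [∀ j, Fintype (I j)] {X : Type} [Fintype X]

/-- A product of sums of product operators, applied to a power of `ψ`. -/
theorem kron_sum_mulVec_tensorPow {N : ℕ} {K : Fin k → Type} (ψ : Tensor I)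
    (s : ∀ j, K j → X → ℂ) (R : ∀ j, K j → X → Fin N → I j → ℂ) (x : ∀ j, K j) :
    (kron (fun j => (Matrix.of fun x y => ∑ i, s j x i * ∏ a, R j x i a (y a) :
      Matrix (K j) (Fin N → I j) ℂ)) *ᵥ tensorPow ψ N) x =
      ∑ ι : Fin k → X, (∏ j, s j (x j) (ι j)) *
        ∏ a, ∑ y : ∀ j, I j, (∏ j, R j (x j) (ι j) a (y j)) * ψ y := by
  classical
  simp only [Matrix.mulVec, dotProduct, kron, Matrix.of_apply, tensorPow]
  simp_rw [Finset.prod_univ_sum, Fintype.piFinset_univ, Finset.sum_mul]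
  rw [Finset.sum_comm]
  refine Finset.sum_congr rfl fun ι _ => ?_
  rw [Finset.mul_sum]
  refine Fintype.sum_equiv (Equiv.piComm fun j (_ : Fin N) => I j) _ _ fun y => ?_
  rw [Finset.prod_mul_distrib, Finset.prod_mul_distrib, Finset.prod_comm, mul_assoc]
  rfl

/-- This is the effect of the GHZ states: of the independent choices of nodes by the parties, only
those constant on blocks survive. -/
theorem sum_eq_sum_block {Q : Type} [Fintype Q] [DecidableEq Q] {c : Fin k → Q}
    (hc : Function.Surjective c) (T : (Fin k → X) → ℂ)
    (hT : ∀ ι : Fin k → X, (¬ ∀ i j, c i = c j → ι i = ι j) → T ι = 0) :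
    ∑ ι, T ι = ∑ μ : Q → X, T (μ ∘ c) := by
  symm
  refine Fintype.sum_of_injective (fun μ : Q → X => μ ∘ c) hc.injective_comp_right _ _
    (fun ι hι => hT ι fun H => hι ?_) fun _ => rfl
  obtain ⟨ρ, hρ⟩ := hc.hasRightInverse
  exact ⟨ι ∘ ρ, funext fun j => H _ _ (hρ _)⟩

end Power

/-- Interpolation with coherence provided by GHZ states that are extracted from `k² ℓ` copies of
`ψ`. -/
theorem IsDegeneration.exists_protocol {k : ℕ} (hk : 0 < k) {I J : Fin k → Type}
    [∀ j, Fintype (I j)] [∀ j, DecidableEq (I j)] [∀ j, Fintype (J j)] [∀ j, DecidableEq (J j)]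
    {ψ : Tensor I} {φ : Tensor J} (hψ : ψ ≠ 0) (hφ : φ ≠ 0)
    {A : ∀ j, Matrix (J j) (I j) ℂ[T;T⁻¹]} {e : ℕ} (hdeg : IsDegeneration ψ φ A e)
    (hnz : ∀ z : ℂˣ, kronAt A z ≠ 0) :
    ∃ C : ℝ, 1 ≤ C ∧ ∀ (n ℓ : ℕ) (X : Type) [Fintype X] (z : X → ℂˣ) (w : X → ℂ) (M : ℝ),
      Fintype.card X ≤ 2 ^ ℓ →
      (∀ f : Polynomial ℂ, f.natDegree ≤ n * e → ∑ i, w i * f.eval (z i : ℂ) = f.eval 0) →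
      ∑ i, ‖w i‖ * opNorm (kronAt A (z i)) ^ n ≤ M →
      ∃ p : ℝ, ((C ^ (ℓ + 1) * M)⁻¹) ^ 2 ≤ p ∧
        LOCC (tensorPow φ n) (tensorPow ψ (n + ℓ * (k * k))) p := by
  classical
  obtain ⟨Q, _, _, c, f, F, hc, hf, hF⟩ := exists_block_decomposition hk hψ
  obtain ⟨P, m, D, hPD, hDe, hm, hP0, hP⟩ := hdeg.exists_blocks hf hφ
  obtain ⟨ρ, hρ⟩ := hc.hasRightInverse
  -- A common bound for the norms of all rows of the extraction operators. The summand 1 makes it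
  -- dominate square roots as well.
  set κ : ℝ := 1 + ∑ p, ∑ j, ∑ s, ∑ y, ‖F p j s y‖ ^ 2 with hκ
  have hκ1 : 1 ≤ κ := by
    rw [hκ, le_add_iff_nonneg_right]; positivity
  have hFκ : ∀ p j s, √(∑ y, ‖F p j s y‖ ^ 2) ≤ κ := fun p j s => by
    have h0 : ∑ y, ‖F p j s y‖ ^ 2 ≤ ∑ p, ∑ j, ∑ s, ∑ y, ‖F p j s y‖ ^ 2 := by
      refine le_trans ?_ (Finset.single_le_sum (f := fun p => ∑ j, ∑ s, ∑ y, ‖F p j s y‖ ^ 2)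
        (fun _ _ => by positivity) (Finset.mem_univ p))
      refine le_trans ?_ (Finset.single_le_sum (f := fun j => ∑ s, ∑ y, ‖F p j s y‖ ^ 2)
        (fun _ _ => by positivity) (Finset.mem_univ j))
      exact Finset.single_le_sum (f := fun s => ∑ y, ‖F p j s y‖ ^ 2)
        (fun _ _ => by positivity) (Finset.mem_univ s)
    rw [Real.sqrt_le_left (by linarith)]
    have h1 : 0 ≤ ∑ y, ‖F p j s y‖ ^ 2 := by positivity
    nlinarith
  refine ⟨max ((κ ^ (k * k) * 2) ^ k) (2 ^ Fintype.card Q), ?_, ?_⟩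
  · exact le_max_of_le_right (one_le_pow₀ one_le_two)
  intro n ℓ X _ z w M hX hw hM
  set C : ℝ := max ((κ ^ (k * k) * 2) ^ k) (2 ^ Fintype.card Q) with hC
  set B : X → ∀ j, Matrix (J j) (I j) ℂ :=
    fun i j => (A j).map (LaurentPolynomial.eval₂ (RingHom.id ℂ) (z i)) with hB
  have hBpos : ∀ i j, 0 < opNorm (B i j) := fun i j => by
    refine lt_of_le_of_ne (opNorm_nonneg _) fun h => hnz (z i) ?_
    rw [← opNorm_eq_zero, kronAt, opNorm_kron]
    exact Finset.prod_eq_zero (Finset.mem_univ j) h.symm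
  have hz : ∀ i, (z i : ℂ) ≠ 0 := fun i => (z i).ne_zero
  -- The cost of node `i` in block `b`. The factors `z ^ m b` come from the shifts of the block
  -- polynomials and cancel over all blocks because `∑ b, m b = 0`.
  set g : Q → X → ℝ := fun b i =>
    (‖(z i : ℂ) ^ m b‖ ^ n)⁻¹ * ∏ j : {j // c j = b}, opNorm (B i j) ^ n with hg
  have hgpos : ∀ b i, 0 < g b i := fun b i => by
    have h1 : 0 < ‖(z i : ℂ) ^ m b‖ := norm_pos_iff.2 (zpow_ne_zero _ (hz i))
    have h2 : 0 < ∏ j : {j // c j = b}, opNorm (B i j) ^ n :=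
      Finset.prod_pos fun j _ => pow_pos (hBpos i j) n
    positivity
  have hgprod : ∀ i, ∏ b, g b i = opNorm (kronAt A (z i)) ^ n := fun i => by
    rw [hg, Finset.prod_mul_distrib,
      Fintype.prod_fiberwise c fun j => opNorm (B i j) ^ n, kronAt, opNorm_kron,
      Finset.prod_pow, Finset.prod_inv_distrib, Finset.prod_pow, ← norm_prod,
      prod_zpow_sum _ (hz i), hm, zpow_zero, norm_one, one_pow, inv_one, one_mul]
  obtain ⟨w', hw', hw'M⟩ := exists_block_weights (D := fun b => n * D b) (d := n * e)
    (by rw [← Finset.mul_sum]; exact Nat.mul_le_mul_left n hDe) hgpos hw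
    (by simp_rw [hgprod]; exact hM)
  set S : Q → ℝ := fun b => ∑ i, ‖w' b i‖ * g b i with hS
  have hSpos : ∀ b, 0 < S b := fun b => by
    have h1 := hw' b 1 (by simp)
    simp only [Polynomial.eval_one, mul_one] at h1
    obtain ⟨i, -, hi⟩ := Finset.exists_ne_zero_of_sum_ne_zero (h1.trans_ne one_ne_zero)
    exact Finset.sum_pos' (fun i _ => mul_nonneg (norm_nonneg _) (hgpos b i).le)
      ⟨i, Finset.mem_univ i, mul_pos (norm_pos_iff.2 hi) (hgpos b i)⟩
  have hXpos : 0 < Fintype.card X := by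
    have h1 := hw 1 (by simp)
    rw [Fintype.card_pos_iff]
    by_contra h
    rw [not_nonempty_iff] at h
    simp at h1
  -- Nodes are encoded by `ℓ` bits; each bit is compared within the blocks by one group of `k * k`
  -- copies of `ψ`, a copy for each pair of parties.
  obtain ⟨bit⟩ : Nonempty (X ↪ (Fin ℓ → Fin 2)) := Function.Embedding.nonempty_of_card_le (by
    simpa using hX)
  set G : Q → X → ℂ := fun b i =>
    w' b i * (((z i : ℂ) ^ m b) ^ n)⁻¹ * ∏ j : {j // c j = b}, (opNorm (B i j) : ℂ) ^ n with hG
  have hGnorm : ∀ b i, ‖G b i‖ = ‖w' b i‖ * g b i := fun b i => by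
    rw [hG, hg, norm_mul, norm_mul, norm_inv, norm_pow, norm_prod, mul_assoc]
    congr 2
    refine Finset.prod_congr rfl fun j _ => ?_
    rw [norm_pow, Complex.norm_real, Real.norm_of_nonneg (opNorm_nonneg _)]
  -- Every party normalizes `A_j(z_i)^{⊗n}` to norm 1 at each node; the root of a block restores the
  -- norms of its block and inserts the weight.
  set s : Fin k → X → ℂ := fun j i =>
    ((opNorm (B i j) : ℂ) ^ n)⁻¹ * if j = ρ (c j) then G (c j) i else 1 with hs
  have hsprod : ∀ μ : Q → X, ∏ j, s j (μ (c j)) =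
      ∏ b, w' b (μ b) * (((z (μ b) : ℂ) ^ m b) ^ n)⁻¹ := fun μ => by
    rw [hs, Finset.prod_mul_distrib, prod_root hρ fun b => G b (μ b), ← Fintype.prod_fiberwise c,
      ← Finset.prod_mul_distrib]
    refine Finset.prod_congr rfl fun b _ => ?_
    rw [hG, Finset.prod_inv_distrib]
    have h1 : ∏ j : {j // c j = b}, (opNorm (B (μ (c j)) j) : ℂ) ^ n =
        ∏ j : {j // c j = b}, (opNorm (B (μ b) j) : ℂ) ^ n :=
      Finset.prod_congr rfl fun j _ => by rw [j.2]
    have h2 : ∏ j : {j // c j = b}, (opNorm (B (μ b) j) : ℂ) ^ n ≠ 0 :=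
      Finset.prod_ne_zero_iff.2 fun j _ => pow_ne_zero _ (by exact_mod_cast (hBpos _ _).ne')
    rw [h1, mul_comm, mul_assoc, mul_inv_cancel₀ h2, mul_one]
  obtain ⟨ε⟩ : Nonempty (Fin (n + ℓ * (k * k)) ≃ Fin n ⊕ (Fin ℓ × (Fin k × Fin k))) :=
    ⟨Fintype.equivOfCardEq (by simp)⟩
  let R : ∀ j, (Fin n → J j) → X → Fin (n + ℓ * (k * k)) → I j → ℂ := fun j x i a y =>
    Sum.elim (fun a => B i j (x a) y) (fun τ => F τ.2 j (bit i τ.1) y) (ε a)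
  let E : ∀ j, Matrix (Fin n → J j) (Fin (n + ℓ * (k * k)) → I j) ℂ := fun j =>
    Matrix.of fun x y => ∑ i, s j i * ∏ a, R j x i a (y a)
  have hE : kron E *ᵥ tensorPow ψ (n + ℓ * (k * k)) = tensorPow φ n := by
    funext x
    rw [kron_sum_mulVec_tensorPow ψ (fun j _ => s j) R x]
    have hinner : ∀ ι : Fin k → X,
        ∏ a, ∑ y : ∀ j, I j, (∏ j, R j (x j) (ι j) a (y j)) * ψ y =
          (∏ a : Fin n, (kron (fun j => B (ι j) j) *ᵥ ψ) fun j => x j a) *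
            if ∀ i j, c i = c j → ι i = ι j then 1 else 0 := fun ι => by
      rw [← Equiv.prod_comp ε.symm, Fintype.prod_sum_type, Fintype.prod_prod_type]
      simp only [R, Equiv.apply_symm_apply, Sum.elim_inl, Sum.elim_inr]
      congr 1
      have h1 : ∀ t : Fin ℓ, ∏ p, ∑ y : ∀ j, I j, (∏ j, F p j (bit (ι j) t) (y j)) * ψ y =
          if ∀ i j, c i = c j → bit (ι i) t = bit (ι j) t then 1 else 0 := fun t =>
        hF fun j => bit (ι j) t
      rw [Finset.prod_congr rfl fun t _ => h1 t, Finset.prod_ite_zero, Finset.prod_const_one]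
      congr 1
      refine propext ⟨fun H i j hij => bit.injective (funext fun t => H t (Finset.mem_univ t) i j hij),
        fun H t _ i j hij => by rw [H i j hij]⟩
    simp_rw [hinner]
    rw [sum_eq_sum_block hc _ fun ι hι => by rw [if_neg hι, mul_zero, mul_zero]]
    have hterm : ∀ μ : Q → X, (∏ j, s j ((μ ∘ c) j)) *
        ((∏ a : Fin n, (kron (fun j => B ((μ ∘ c) j) j) *ᵥ ψ) fun j => x j a) *
            if ∀ i j, c i = c j → (μ ∘ c) i = (μ ∘ c) j then 1 else 0) =
        ∏ b, w' b (μ b) * (∏ a : Fin n, P b fun j => x j a).eval (z (μ b) : ℂ) := fun μ => by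
      have hcond : ∀ i j, c i = c j → (μ ∘ c) i = (μ ∘ c) j := fun i j hij => congrArg μ hij
      rw [if_pos hcond, mul_one]
      simp only [Function.comp_apply]
      rw [hsprod]
      have h1 : ∀ a : Fin n, (kron (fun j => B (μ (c j)) j) *ᵥ ψ) (fun j => x j a) =
          ∏ b, (z (μ b) : ℂ) ^ m b * (P b fun j => x j a).eval (z (μ b) : ℂ) := fun a => by
        rw [show ψ = fun y => ∏ b, f b fun j => y j from funext hf, kron_mulVec_block]
        refine Finset.prod_congr rfl fun b _ => ?_
        rw [← hP]
        refine Finset.sum_congr rfl fun y _ => ?_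
        congr 1
        exact Finset.prod_congr rfl fun j _ => by rw [j.2]
      simp_rw [h1]
      rw [Finset.prod_comm, ← Finset.prod_mul_distrib]
      refine Finset.prod_congr rfl fun b _ => ?_
      rw [Finset.prod_mul_distrib, Finset.prod_const, Finset.card_univ, Fintype.card_fin,
        Polynomial.eval_prod, mul_assoc, inv_mul_cancel_left₀]
      exact pow_ne_zero _ (zpow_ne_zero _ (hz _))
    rw [Finset.sum_congr rfl fun μ _ => hterm μ, ← Fintype.piFinset_univ,
      ← Finset.prod_univ_sum (fun _ => Finset.univ)
        fun b i => w' b i * (∏ a : Fin n, P b fun j => x j a).eval (z i : ℂ)]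
    have h2 : ∀ b, ∑ i, w' b i * (∏ a : Fin n, P b fun j => x j a).eval (z i : ℂ) =
        ∏ a : Fin n, (P b fun j => x j a).eval 0 := fun b => by
      rw [hw' b _ ((Polynomial.natDegree_prod_le _ _).trans
        ((Finset.sum_le_sum fun a _ => hPD b _).trans (by simp))), Polynomial.eval_prod]
    simp_rw [h2]
    rw [Finset.prod_comm]
    exact Finset.prod_congr rfl fun a _ => hP0 fun j => x j a
  -- By the triangle inequality over the nodes, a root costs `S` and any other party `Fintype.card
  -- X`, besides the extraction. One crude bound covers both cases, since the number of nodes is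
  -- only polynomial in the application.
  set β : Fin k → ℝ := fun j => (κ ^ (k * k)) ^ ℓ * Fintype.card X *
    if j = ρ (c j) then S (c j) else 1 with hβ
  have hβpos : ∀ j, 0 < β j := fun j => by
    have : (0 : ℝ) < Fintype.card X := by exact_mod_cast hXpos
    have : 0 < if j = ρ (c j) then S (c j) else 1 := by
      split_ifs; exacts [hSpos _, one_pos]
    positivity
  have hEβ : ∀ j, opNorm (E j) ≤ β j := by
    intro j
    have h1 : E j = ∑ i, s j i • (Matrix.of fun x y => ∏ a, R j x i a (y a) :
        Matrix (Fin n → J j) (Fin (n + ℓ * (k * k)) → I j) ℂ) := by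
      ext x y
      simp [E, Matrix.sum_apply]
    have h2 : ∀ i, opNorm (Matrix.of fun x y => ∏ a, R j x i a (y a) :
        Matrix (Fin n → J j) (Fin (n + ℓ * (k * k)) → I j) ℂ) ≤
        opNorm (B i j) ^ n * (κ ^ (k * k)) ^ ℓ := fun i => by
      have h3 := opNorm_tensor_row_le ((Equiv.arrowCongr ε (Equiv.refl (I j))).trans
        (Equiv.sumArrowEquivProdArrow _ _ _)) (kron fun _ : Fin n => B i j)
        (fun y => ∏ τ : Fin ℓ × (Fin k × Fin k), F τ.2 j (bit i τ.1) (y τ))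
      have h4 : (Matrix.of fun (x : Fin n → J j) (y : Fin (n + ℓ * (k * k)) → I j) =>
          ∏ a, R j x i a (y a)) = Matrix.of fun x y => (kron fun _ : Fin n => B i j) x
          (((Equiv.arrowCongr ε (Equiv.refl (I j))).trans
            (Equiv.sumArrowEquivProdArrow _ _ _)) y).1 *
          ∏ τ : Fin ℓ × (Fin k × Fin k), F τ.2 j (bit i τ.1) ((((Equiv.arrowCongr ε
            (Equiv.refl (I j))).trans (Equiv.sumArrowEquivProdArrow _ _ _)) y).2 τ) := by
        ext x y
        simp only [Matrix.of_apply]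
        rw [← Equiv.prod_comp ε.symm, Fintype.prod_sum_type]
        simp only [R, Equiv.apply_symm_apply, Sum.elim_inl, Sum.elim_inr]
        rfl
      rw [h4]
      refine h3.trans ?_
      rw [opNorm_kron, Finset.prod_const, Finset.card_univ, Fintype.card_fin]
      refine mul_le_mul_of_nonneg_left ?_ (pow_nonneg (opNorm_nonneg _) _)
      have h5 : ∑ y : (Fin ℓ × (Fin k × Fin k)) → I j,
          ‖∏ τ : Fin ℓ × (Fin k × Fin k), F τ.2 j (bit i τ.1) (y τ)‖ ^ 2 =
          ∏ τ : Fin ℓ × (Fin k × Fin k), ∑ y, ‖F τ.2 j (bit i τ.1) y‖ ^ 2 := by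
        rw [Finset.prod_univ_sum, Fintype.piFinset_univ]
        simp [Finset.prod_pow]
      rw [h5, Real.sqrt_prod _ fun _ _ => by positivity]
      refine (Finset.prod_le_prod (fun _ _ => Real.sqrt_nonneg _) fun τ _ =>
        hFκ τ.2 j (bit i τ.1)).trans_eq ?_
      rw [Finset.prod_const, Finset.card_univ, Fintype.card_prod, Fintype.card_prod,
        Fintype.card_fin, Fintype.card_fin, ← pow_mul, mul_comm]
    have h3 : ∀ i, ‖s j i‖ * opNorm (B i j) ^ n = if j = ρ (c j) then ‖w' (c j) i‖ * g (c j) i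
        else 1 := fun i => by
      rw [hs, norm_mul, norm_inv, norm_pow, Complex.norm_real,
        Real.norm_of_nonneg (opNorm_nonneg _), mul_comm, ← mul_assoc,
        mul_inv_cancel₀ (pow_ne_zero _ (hBpos i j).ne'), one_mul]
      split_ifs
      · exact hGnorm _ _
      · exact norm_one
    have hX1 : (1 : ℝ) ≤ Fintype.card X := by exact_mod_cast hXpos
    calc opNorm (E j) ≤ ∑ i, ‖s j i‖ * (opNorm (B i j) ^ n * (κ ^ (k * k)) ^ ℓ) := by
          rw [h1]
          refine (opNorm_sum_le _ _).trans (Finset.sum_le_sum fun i _ => ?_)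
          rw [opNorm_smul]
          exact mul_le_mul_of_nonneg_left (h2 i) (norm_nonneg _)
      _ = (κ ^ (k * k)) ^ ℓ * ∑ i, if j = ρ (c j) then ‖w' (c j) i‖ * g (c j) i else 1 := by
          rw [Finset.mul_sum]
          refine Finset.sum_congr rfl fun i _ => ?_
          rw [← h3, ← mul_assoc, mul_comm]
      _ ≤ β j := by
          simp only [hβ]
          rw [mul_assoc]
          refine mul_le_mul_of_nonneg_left ?_ (by positivity)
          split_ifs
          · exact le_mul_of_one_le_left (hSpos _).le hX1
          · simp
  refine ⟨_, ?_, LOCC.of_kron_mulVec hk hβpos hEβ hE⟩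
  have hprod : ∏ j, β j ≤ C ^ (ℓ + 1) * M := by
    have h1 : ∏ j, β j = ((κ ^ (k * k)) ^ ℓ * Fintype.card X) ^ k * ∏ b, S b := by
      rw [hβ, Finset.prod_mul_distrib, prod_root hρ, Finset.prod_const, Finset.card_univ,
        Fintype.card_fin]
    have hM0 : 0 ≤ M := le_trans (Finset.sum_nonneg fun i _ =>
      mul_nonneg (norm_nonneg _) (pow_nonneg (opNorm_nonneg _) _)) hM
    have hX2 : (Fintype.card X : ℝ) ≤ 2 ^ ℓ := by exact_mod_cast hX
    calc ∏ j, β j ≤ ((κ ^ (k * k)) ^ ℓ * 2 ^ ℓ) ^ k * (2 ^ Fintype.card Q * M) := by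
          rw [h1]
          refine mul_le_mul ?_ hw'M (Finset.prod_nonneg fun b _ => (hSpos b).le) (by positivity)
          gcongr
      _ = ((κ ^ (k * k) * 2) ^ k) ^ ℓ * (2 ^ Fintype.card Q * M) := by
          rw [← mul_pow, pow_right_comm]
      _ ≤ C ^ ℓ * (C * M) := by
          gcongr
          · exact le_max_left _ _
          · exact le_max_right _ _
      _ = C ^ (ℓ + 1) * M := by ring
  have hpos : 0 < ∏ j, β j := Finset.prod_pos fun j _ => hβpos j
  exact pow_le_pow_left₀ (inv_nonneg.2 (hpos.le.trans hprod)) (inv_anti₀ hpos hprod) 2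

end

/-! ### Random sampling of interpolation nodes -/

noncomputable section

open ProbabilityTheory in
/-- The weak law of large numbers on finite product spaces. -/
theorem tendsto_pi_sum_gt {α : Type} [MeasurableSpace α] (μ : Measure α) [IsProbabilityMeasure μ]
    {f : α → ℝ} (hfm : Measurable f) (hf : Integrable f μ) {ε : ℝ} (hε : 0 < ε) :
    Tendsto (fun D : ℕ => Measure.pi (fun _ : Fin D => μ)
      {t | D * (∫ x, f x ∂μ + ε) < ∑ j, f (t j)}) atTop (𝓝 0) := by
  -- The strong law on the infinite product gives convergence in measure, which is then pushed
  -- forward to the first `D` coordinates.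
  let P : Measure (ℕ → α) := Measure.infinitePi fun _ => μ
  have hev : ∀ i, P.map (fun ω : ℕ → α => ω i) = μ := fun i =>
    Measure.infinitePi_map_eval (fun _ : ℕ => μ) i
  have hindep : iIndepFun (fun (i : ℕ) (ω : ℕ → α) => f (ω i)) P :=
    iIndepFun_infinitePi (P := fun _ => μ) (X := fun _ => f) fun _ => hfm
  have hint : Integrable (fun ω : ℕ → α => f (ω 0)) P := by
    have h : Integrable f (P.map fun ω : ℕ → α => ω 0) := by rw [hev]; exact hf
    exact h.comp_measurable (measurable_pi_apply 0)
  have hmean : ∫ ω, f (ω 0) ∂P = ∫ x, f x ∂μ := by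
    rw [← integral_map (φ := fun ω : ℕ → α => ω 0)
      (measurable_pi_apply 0).aemeasurable (by
      rw [hev]; exact hfm.aestronglyMeasurable), hev]
  have hslln := strong_law_ae_real (μ := P) (fun i ω => f (ω i)) hint
    (fun i j hij => hindep.indepFun hij)
    (fun i => by
      refine IdentDistrib.comp (u := f) ⟨(measurable_pi_apply i).aemeasurable, (measurable_pi_apply 0).aemeasurable, ?_⟩ hfm
      rw [hev, hev])
  rw [hmean] at hslln
  have hmeas : ∀ D : ℕ, AEStronglyMeasurable
      (fun ω : ℕ → α => (∑ i ∈ Finset.range D, f (ω i)) / D) P := fun D => by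
    refine Measurable.aestronglyMeasurable ?_
    fun_prop
  have hP := tendstoInMeasure_of_tendsto_ae hmeas hslln (ENNReal.ofReal ε)
    (ENNReal.ofReal_pos.2 hε)
  refine tendsto_of_tendsto_of_tendsto_of_le_of_le' tendsto_const_nhds hP
    (Eventually.of_forall fun _ => zero_le) ?_
  filter_upwards [eventually_gt_atTop 0] with D hD
  have hmap : P.map (fun ω (j : Fin D) => ω j) = Measure.pi fun _ => μ := by
    have h := (iIndepFun_iff_map_fun_eq_pi_map (μ := P)
      (f := fun (j : Fin D) (ω : ℕ → α) => ω j) (fun j => (measurable_pi_apply (j : ℕ)).aemeasurable)).1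
      ((iIndepFun_infinitePi (P := fun _ : ℕ => μ) (X := fun _ => id)
        (fun _ => measurable_id)).precomp Fin.val_injective)
    simpa only [hev] using h
  rw [← hmap, Measure.map_apply (by fun_prop) (measurableSet_lt (by fun_prop) (by fun_prop))]
  refine measure_mono fun ω hω => ?_
  have hD' : (0 : ℝ) < D := by exact_mod_cast hD
  simp only [Set.mem_preimage, Set.mem_ofPred_eq] at hω ⊢
  rw [Fin.sum_univ_eq_sum_range fun i => f (ω i)] at hω
  rw [edist_dist, Real.dist_eq]
  refine ENNReal.ofReal_le_ofReal (le_trans ?_ (le_abs_self _))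
  rw [le_sub_iff_add_le, le_div_iff₀ hD']
  linarith

/-- The logarithmic kernel normalized at the origin. -/
def logKernel (z t : ℂ) : ℝ := Real.logb 2 (‖t‖ / ‖z - t‖)

theorem measurable_logKernel : Measurable fun p : ℂ × ℂ => logKernel p.1 p.2 := by
  unfold logKernel Real.logb
  fun_prop

theorem measurable_logKernel_right (z : ℂ) : Measurable (logKernel z) :=
  measurable_logKernel.comp measurable_prodMk_left

section Sampling

variable {μ : Measure ℂ} [IsProbabilityMeasure μ]

/-- The points that are too close, on average, to the sample `t`. -/
def badSet (μ : Measure ℂ) (ε : ℝ) (D : ℕ) : Set (ℂ × (Fin D → ℂ)) :=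
  {p | D * (∫ x, logKernel p.1 x ∂μ + ε) < ∑ j, logKernel p.1 (p.2 j)} ∪ {p | ∃ j, p.2 j = p.1}

theorem measurableSet_badSet (ε : ℝ) (D : ℕ) : MeasurableSet (badSet μ ε D) := by
  have h1 : Measurable fun p : ℂ × (Fin D → ℂ) => ∫ x, logKernel p.1 x ∂μ :=
    (measurable_logKernel.stronglyMeasurable.integral_prod_right.measurable).comp measurable_fst
  refine (measurableSet_lt ?_ ?_).union ?_
  · exact (h1.add_const ε).const_mul _
  · exact Finset.measurable_sum _ fun j _ => measurable_logKernel.comp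
      (measurable_fst.prodMk ((measurable_pi_apply j).comp measurable_snd))
  · simp only [Set.ofPred_exists]
    exact MeasurableSet.iUnion fun j => measurableSet_eq_fun
      ((measurable_pi_apply j).comp measurable_snd) measurable_fst

/-- For almost every fixed `z` the law of large numbers applies to `logKernel z`, and a sample point
hits `z` with probability 0. Dominated convergence then integrates over `z`. -/
theorem tendsto_prod_badSet (hatom : ∀ z, μ {z} = 0)
    (hint : ∀ᵐ z ∂μ, Integrable (logKernel z) μ) {ε : ℝ} (hε : 0 < ε) :
    Tendsto (fun D : ℕ => (μ.prod (Measure.pi fun _ : Fin D => μ)) (badSet μ ε D))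
      atTop (𝓝 0) := by
  simp_rw [Measure.prod_apply (measurableSet_badSet _ _)]
  rw [← lintegral_zero (μ := μ)]
  refine tendsto_lintegral_of_dominated_convergence (fun _ => 1)
    (fun D => measurable_measure_prodMk_left (measurableSet_badSet _ _))
    (fun D => Eventually.of_forall fun z => prob_le_one) (by simp) ?_
  filter_upwards [hint] with z hz
  refine tendsto_of_tendsto_of_tendsto_of_le_of_le tendsto_const_nhds
    (tendsto_pi_sum_gt μ (measurable_logKernel_right z) hz hε) (fun _ => zero_le) fun D => ?_
  have h0 : Measure.pi (fun _ : Fin D => μ) {t | ∃ j, t j = z} = 0 := by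
    rw [Set.ofPred_exists, measure_iUnion_null_iff]
    intro j
    have h1 : {t : Fin D → ℂ | t j = z} = (fun t : Fin D → ℂ => t j) ⁻¹' {z} := by ext t; simp
    rw [h1]
    exact Measure.pi_eval_preimage_null (fun _ : Fin D => μ) (hatom z)
  calc Measure.pi (fun _ : Fin D => μ) (Prod.mk z ⁻¹' badSet μ ε D)
      ≤ Measure.pi (fun _ : Fin D => μ)
          {t | D * (∫ x, logKernel z x ∂μ + ε) < ∑ j, logKernel z (t j)} +
        Measure.pi (fun _ : Fin D => μ) {t | ∃ j, t j = z} := measure_union_le _ _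
    _ = _ := by rw [h0, add_zero]

open Classical in
/-- A sample in which few points are bad. -/
theorem exists_sample {p : ℂ → Prop} (hp : ∀ᵐ z ∂μ, p z) (ε : ℝ) {D : ℕ} {θ : ℝ} (hθ : 0 ≤ θ)
    (hbad : (μ.prod (Measure.pi fun _ : Fin D => μ)) (badSet μ ε D) ≤ ENNReal.ofReal θ) :
    ∃ t : Fin (D + 1) → ℂ, (∀ i, p (t i)) ∧
      ((Finset.univ.filter fun i => (t i, fun j => t (i.succAbove j)) ∈ badSet μ ε D).card : ℝ) ≤
        (D + 1) * θ := by
  let Ω : Measure (Fin (D + 1) → ℂ) := Measure.pi fun _ => μ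
  let S : Fin (D + 1) → Set (Fin (D + 1) → ℂ) := fun i =>
    {t | (t i, fun j => t (i.succAbove j)) ∈ badSet μ ε D}
  have hmp : ∀ i, MeasurePreserving (MeasurableEquiv.piFinSuccAbove (fun _ => ℂ) i) Ω
      (μ.prod (Measure.pi fun _ : Fin D => μ)) := fun i =>
    measurePreserving_piFinSuccAbove (fun _ => μ) i
  have hSm : ∀ i, MeasurableSet (S i) := fun i =>
    (MeasurableEquiv.piFinSuccAbove (fun _ => ℂ) i).measurable (measurableSet_badSet ε D)
  have hS : ∀ i, Ω (S i) ≤ ENNReal.ofReal θ := fun i => by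
    rw [← (hmp i).measure_preimage (measurableSet_badSet ε D).nullMeasurableSet] at hbad
    exact hbad
  have hall : ∀ᵐ t ∂Ω, ∀ i, p (t i) := eventually_all.2 fun i =>
    Measure.tendsto_eval_ae_ae.eventually hp
  -- Each of the `D + 1` points is bad relative to the others with probability at most `θ`, so some
  -- sample outside a null set has no more bad points than the mean.
  obtain ⟨t, ht, hle⟩ := exists_notMem_null_le_lintegral (μ := Ω)
    (f := fun t => ∑ i, (S i).indicator 1 t)
    (Finset.measurable_sum _ fun i _ => measurable_one.indicator (hSm i)).aemeasurable
    (ae_iff.1 hall)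
  refine ⟨t, by simpa using ht, ?_⟩
  have h1 : ∫⁻ t, ∑ i, (S i).indicator 1 t ∂Ω ≤ ENNReal.ofReal ((D + 1) * θ) := by
    rw [lintegral_finsetSum _ fun i _ => measurable_one.indicator (hSm i)]
    simp_rw [lintegral_indicator_one (hSm _)]
    refine (Finset.sum_le_sum fun i _ => hS i).trans ?_
    rw [Finset.sum_const, Finset.card_univ, Fintype.card_fin, nsmul_eq_mul,
      ENNReal.ofReal_mul (by positivity)]
    gcongr
    rw [← Nat.cast_succ, ENNReal.ofReal_natCast]
  have h2 : ∑ i, (S i).indicator (1 : (Fin (D + 1) → ℂ) → ℝ≥0∞) t = ((Finset.univ.filter fun i =>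
      (t i, fun j => t (i.succAbove j)) ∈ badSet μ ε D).card : ℝ≥0∞) := by
    rw [Finset.card_filter]
    push_cast
    exact Finset.sum_congr rfl fun i _ => by simp [S, Set.indicator_apply]
  have h3 := (h2.symm.le.trans hle).trans h1
  rw [← ENNReal.ofReal_natCast] at h3
  exact (ENNReal.ofReal_le_ofReal_iff (by positivity)).1 h3

/-- Finite sets of points whose discrete logarithmic potentials are bounded by that of `μ`. -/
theorem eventually_exists_finset {p : ℂ → Prop} (hp : ∀ᵐ z ∂μ, p z) {H : ℝ} (hH : 0 ≤ H)
    (hpH : ∀ z t, p z → p t → -logKernel z t ≤ H) (hatom : ∀ z, μ {z} = 0)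
    (hint : ∀ᵐ z ∂μ, Integrable (logKernel z) μ) {ε : ℝ} (hε : 0 < ε) :
    ∀ᶠ D : ℕ in atTop, ∃ T : Finset ℂ, (1 - ε) * D ≤ T.card ∧ T.card ≤ D + 1 ∧
      ∀ z ∈ T, p z ∧ ∑ t ∈ T.erase z, logKernel z t ≤ D * (∫ x, logKernel z x ∂μ + ε) := by
  classical
  -- Dropping a bad point raises a kernel sum by at most `H`. At most `(D + 1) * θ` points are
  -- dropped, which costs at most `D * ε / 2`; the other half of `ε` is spent in the definition of
  -- bad points.
  set θ : ℝ := min 1 (min ε (ε / (4 * (H + 1)))) with hθ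
  have hθ0 : 0 < θ := by positivity
  have hθ1 : θ ≤ 1 := min_le_left _ _
  have hθε : θ ≤ ε := (min_le_right _ _).trans (min_le_left _ _)
  have hθH : θ * H ≤ ε / 4 := by
    have h1 : θ ≤ ε / (4 * (H + 1)) := (min_le_right _ _).trans (min_le_right _ _)
    rw [le_div_iff₀ (by positivity)] at h1
    nlinarith
  have h := (tendsto_prod_badSet hatom hint (half_pos hε)).eventually
    (ge_mem_nhds (ENNReal.ofReal_pos.2 hθ0))
  filter_upwards [h, eventually_gt_atTop 0] with D hD hD0
  have hD1 : (1 : ℝ) ≤ D := by exact_mod_cast hD0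
  obtain ⟨t, ht, hcard⟩ := exists_sample hp (ε / 2) hθ0.le hD
  set bad := Finset.univ.filter fun i =>
    (t i, fun j => t (i.succAbove j)) ∈ badSet μ (ε / 2) D with hbad
  have hgood : ∀ i ∉ bad, (∑ j, logKernel (t i) (t (i.succAbove j)) ≤
      D * (∫ x, logKernel (t i) x ∂μ + ε / 2)) ∧ ∀ j, j ≠ i → t j ≠ t i := by
    intro i hi
    simp only [hbad, badSet, Finset.mem_filter, Finset.mem_univ, true_and, Set.mem_union,
      Set.mem_ofPred_eq, not_or, not_lt, not_exists] at hi
    refine ⟨hi.1, fun j hj => ?_⟩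
    obtain ⟨l, rfl⟩ := Fin.exists_succAbove_eq hj
    exact hi.2 l
  -- Points that coincide with another sample point are bad by definition, so the remaining ones are
  -- distinct.
  have hinj : Set.InjOn t (badᶜ : Finset (Fin (D + 1))) := fun i _ j hj hij => by
    by_contra hne
    exact (hgood j (by simpa using hj)).2 i hne hij
  have hTcard : ((badᶜ).image t).card = D + 1 - bad.card := by
    rw [Finset.card_image_of_injOn hinj, Finset.card_compl, Fintype.card_fin]
  have hle : bad.card ≤ D + 1 := by simpa using Finset.card_le_univ bad
  refine ⟨(badᶜ).image t, ?_, ?_, ?_⟩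
  · rw [hTcard, Nat.cast_sub hle]
    push_cast
    nlinarith
  · rw [hTcard]; exact Nat.sub_le _ _
  · intro z hz
    obtain ⟨i, hi, rfl⟩ := Finset.mem_image.1 hz
    refine ⟨ht i, ?_⟩
    have hi' : i ∉ bad := by simpa using hi
    have h1 : ((badᶜ).image t).erase (t i) = (badᶜ.erase i).image t := by
      ext y
      simp only [Finset.mem_erase, Finset.mem_image, Finset.mem_compl]
      constructor
      · rintro ⟨hne, j, hj, rfl⟩
        exact ⟨j, ⟨fun h => hne (by rw [h]), hj⟩, rfl⟩
      · rintro ⟨j, ⟨hji, hj⟩, rfl⟩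
        exact ⟨(hgood i hi').2 j hji, j, hj, rfl⟩
    rw [h1, Finset.sum_image (hinj.mono (by
      intro j hj; exact Finset.mem_coe.2 (Finset.mem_of_mem_erase (Finset.mem_coe.1 hj))))]
    have h2 : ∑ j ∈ Finset.univ.erase i, logKernel (t i) (t j) =
        ∑ j, logKernel (t i) (t (i.succAbove j)) := by
      have h3 := Fin.sum_univ_succAbove (fun j => logKernel (t i) (t j)) i
      have h4 := Finset.add_sum_erase Finset.univ (fun j => logKernel (t i) (t j))
        (Finset.mem_univ i)
      linarith
    have h5 : ∑ j ∈ badᶜ.erase i, logKernel (t i) (t j) + ∑ j ∈ bad, logKernel (t i) (t j) =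
        ∑ j ∈ Finset.univ.erase i, logKernel (t i) (t j) := by
      rw [← Finset.sum_union]
      · congr 1
        ext j
        simp only [Finset.mem_union, Finset.mem_erase, Finset.mem_compl, Finset.mem_univ, and_true]
        constructor
        · rintro (h | h)
          · exact h.1
          · rintro rfl; exact hi' h
        · intro h
          by_cases hj : j ∈ bad
          · exact Or.inr hj
          · exact Or.inl ⟨h, hj⟩
      · rw [Finset.disjoint_left]
        intro j hj hj'
        exact (Finset.mem_compl.1 (Finset.mem_of_mem_erase hj)) hj'
    have h6 : -∑ j ∈ bad, logKernel (t i) (t j) ≤ bad.card * H := by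
      rw [← Finset.sum_neg_distrib, ← nsmul_eq_mul]
      exact Finset.sum_le_card_nsmul _ _ _ fun j _ => hpH _ _ (ht i) (ht j)
    have h7 : (bad.card : ℝ) * H ≤ (D + 1) * θ * H := mul_le_mul_of_nonneg_right hcard hH
    have h8 := (hgood i hi').1
    nlinarith

end Sampling

end

/-! ### Lagrange weights and logarithmic potentials -/

noncomputable section

open Polynomial in
/-- Lagrange interpolation at the origin. -/
theorem sum_prod_div_mul_eval {T : Finset ℂ} {f : ℂ[X]} (hf : f.natDegree < T.card) :
    ∑ z : T, (∏ t ∈ T.erase z, t / (t - z)) * f.eval (z : ℂ) = f.eval 0 := by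
  have hdeg : f.degree < T.card :=
    lt_of_le_of_lt degree_le_natDegree (by exact_mod_cast hf)
  have h := congrArg (eval (0 : ℂ)) (Lagrange.eq_interpolate (s := T) (f := f)
    (v := (id : ℂ → ℂ)) Function.injective_id.injOn hdeg)
  rw [Lagrange.interpolate_apply, eval_finsetSum, ← Finset.sum_coe_sort] at h
  rw [h]
  refine Finset.sum_congr rfl fun z _ => ?_
  rw [eval_mul, eval_C, mul_comm, Lagrange.basis, eval_prod]
  congr 1
  refine Finset.prod_congr rfl fun t ht => ?_
  have hne : (z : ℂ) - t ≠ 0 := sub_ne_zero.2 (Finset.ne_of_mem_erase ht).symm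
  have hne' : t - (z : ℂ) ≠ 0 := sub_ne_zero.2 (Finset.ne_of_mem_erase ht)
  simp only [Lagrange.basisDivisor, eval_mul, eval_C, eval_sub, eval_X, id]
  field_simp
  ring

theorem norm_prod_div_eq {T : Finset ℂ} (hT : ∀ t ∈ T, t ≠ 0) (z : ℂ) :
    ‖∏ t ∈ T.erase z, t / (t - z)‖ = 2 ^ ∑ t ∈ T.erase z, logKernel z t := by
  rw [norm_prod, Real.rpow_sum_of_pos two_pos]
  refine Finset.prod_congr rfl fun t ht => ?_
  have h1 : 0 < ‖t‖ := norm_pos_iff.2 (hT t (Finset.mem_of_mem_erase ht))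
  have h2 : 0 < ‖z - t‖ := norm_pos_iff.2 (sub_ne_zero.2 (Finset.ne_of_mem_erase ht).symm)
  rw [norm_div, norm_sub_rev, logKernel, Real.rpow_logb two_pos (by norm_num) (by positivity)]

/-- This is `|z - t| ≤ |z| + |t|`. It controls the negative part of the kernel when integrating,
when discarding sample points and when truncating the measure. At `z = t` the kernel has the default
value 0. -/
theorem neg_logKernel_le (z : ℂ) {t : ℂ} (ht : t ≠ 0) :
    -logKernel z t ≤ Real.logb 2 (1 + ‖z‖ / ‖t‖) := by
  have h1 : 0 < ‖t‖ := norm_pos_iff.2 ht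
  rw [logKernel, ← Real.logb_inv, inv_div]
  rcases eq_or_ne z t with rfl | hne
  · rw [sub_self, norm_zero, zero_div, Real.logb_zero]
    exact Real.logb_nonneg one_lt_two (by rw [le_add_iff_nonneg_right]; positivity)
  · have h2 : 0 < ‖z - t‖ := norm_pos_iff.2 (sub_ne_zero.2 hne)
    refine Real.logb_le_logb_of_le one_lt_two (by positivity) ?_
    rw [div_le_iff₀ h1, add_mul, div_mul_cancel₀ _ h1.ne', one_mul, add_comm]
    exact norm_sub_le z t

theorem log2_ofReal {a : ℝ} (ha : 0 < a) : log2 (ENNReal.ofReal a) = (Real.logb 2 a : ℝ) := by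
  rw [log2, ENNReal.log_ofReal_of_pos ha, ← EReal.coe_div, Real.logb]

theorem log2_enorm_div {z t : ℂ} (ht : t ≠ 0) (hzt : z ≠ t) :
    log2 (‖t‖ₑ / ‖z - t‖ₑ) = (logKernel z t : ℝ) := by
  have h1 : 0 < ‖t‖ := norm_pos_iff.2 ht
  have h2 : 0 < ‖z - t‖ := norm_pos_iff.2 (sub_ne_zero.2 hzt)
  rw [← ofReal_norm, ← ofReal_norm, ← ENNReal.ofReal_div_of_pos h2,
    log2_ofReal (by positivity), logKernel]

theorem log2_top : log2 ⊤ = ⊤ := by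
  rw [log2, ENNReal.log_top]
  exact EReal.top_div_of_pos_ne_top (by exact_mod_cast Real.log_pos one_lt_two)
    (EReal.coe_ne_top _)

/-- A finite logarithmic potential is given by an integral. -/
theorem potential_eq_integral {σ : Measure ℂ} [IsProbabilityMeasure σ] {δ : ℝ} (hδ : 0 < δ)
    (hσ : ∀ᵐ t ∂σ, δ ≤ ‖t‖) {z : ℂ} (hz : potential σ z ≠ ⊤) :
    σ {z} = 0 ∧ Integrable (logKernel z) σ ∧
      potential σ z = ((∫ t, logKernel z t ∂σ : ℝ) : EReal) := by
  have hσ0 : ∀ᵐ t ∂σ, t ≠ 0 := hσ.mono fun t ht h => by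
    rw [h, norm_zero] at ht; exact absurd ht (not_le.2 hδ)
  have hneg : ∫⁻ t, (-log2 (‖t‖ₑ / ‖z - t‖ₑ)).toENNReal ∂σ < ⊤ := by
    refine lt_of_le_of_lt (lintegral_mono_ae (g := fun _ =>
      ENNReal.ofReal (Real.logb 2 (1 + ‖z‖ / δ))) ?_) (by simp)
    filter_upwards [hσ, hσ0] with t ht ht0
    rcases eq_or_ne z t with rfl | hne
    · have h1 : ‖z‖ₑ / ‖z - z‖ₑ = ⊤ := by
        rw [sub_self, enorm_zero, ENNReal.div_zero (by simpa using ht0)]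
      rw [h1, log2_top]; simp
    · rw [log2_enorm_div ht0 hne, ← EReal.coe_neg, EReal.real_coe_toENNReal]
      refine ENNReal.ofReal_le_ofReal ((neg_logKernel_le z ht0).trans ?_)
      refine Real.logb_le_logb_of_le one_lt_two (by positivity) ?_
      gcongr
  have hpos : ∫⁻ t, (log2 (‖t‖ₑ / ‖z - t‖ₑ)).toENNReal ∂σ < ⊤ := by
    rw [lt_top_iff_ne_top]
    intro h
    apply hz
    rw [potential, h, EReal.coe_ennreal_top]
    obtain ⟨r, hr⟩ := ENNReal.lt_iff_exists_coe.1 hneg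
    rw [hr.1]
    exact EReal.top_sub_coe (r : ℝ)
  -- An atom at `z` would contribute `∞` to the positive part. Once it is excluded, the point `t =
  -- z`, where `log2` is `∞` but `logKernel` is 0, is null.
  have hatom : σ {z} = 0 := by
    by_contra h0
    have hz0 : z ≠ 0 := by
      rintro rfl
      refine h0 (measure_mono_null ?_ (ae_iff.1 hσ0))
      simp
    have h1 : ∫⁻ t in {z}, (log2 (‖t‖ₑ / ‖z - t‖ₑ)).toENNReal ∂σ = ⊤ := by
      rw [Measure.restrict_singleton, lintegral_smul_measure, lintegral_dirac, sub_self,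
        enorm_zero, ENNReal.div_zero (by simpa using hz0), log2_top, EReal.toENNReal_top]
      simp [h0]
    exact absurd (h1.symm.le.trans (setLIntegral_le_lintegral _ _)) (not_le.2 hpos)
  have hne : ∀ᵐ t ∂σ, t ≠ z := by
    rw [ae_iff]; simpa using hatom
  have hP : ∫⁻ t, (log2 (‖t‖ₑ / ‖z - t‖ₑ)).toENNReal ∂σ =
      ∫⁻ t, ENNReal.ofReal (logKernel z t) ∂σ := by
    refine lintegral_congr_ae ?_
    filter_upwards [hσ0, hne] with t ht0 ht
    rw [log2_enorm_div ht0 ht.symm, EReal.real_coe_toENNReal]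
  have hN : ∫⁻ t, (-log2 (‖t‖ₑ / ‖z - t‖ₑ)).toENNReal ∂σ =
      ∫⁻ t, ENNReal.ofReal (-logKernel z t) ∂σ := by
    refine lintegral_congr_ae ?_
    filter_upwards [hσ0, hne] with t ht0 ht
    rw [log2_enorm_div ht0 ht.symm, ← EReal.coe_neg, EReal.real_coe_toENNReal]
  rw [hP] at hpos
  rw [hN] at hneg
  have hint : Integrable (logKernel z) σ := by
    refine ⟨(measurable_logKernel_right z).aestronglyMeasurable, ?_⟩
    rw [hasFiniteIntegral_iff_enorm]
    refine lt_of_le_of_lt (lintegral_mono (g := fun t => ENNReal.ofReal (logKernel z t) +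
      ENNReal.ofReal (-logKernel z t)) fun t => ?_) ?_
    · dsimp only
      rw [← ofReal_norm, Real.norm_eq_abs]
      rcases abs_choice (logKernel z t) with h | h <;> rw [h]
      · exact le_self_add
      · exact le_add_self
    · rw [lintegral_add_left (measurable_logKernel_right z).ennreal_ofReal]
      exact ENNReal.add_lt_top.2 ⟨hpos, hneg⟩
  refine ⟨hatom, hint, ?_⟩
  rw [potential, hP, hN, integral_eq_lintegral_pos_part_sub_lintegral_neg_part hint,
    EReal.coe_sub, EReal.coe_ennreal_toReal hpos.ne, EReal.coe_ennreal_toReal hneg.ne]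

end

/-! ### Bounds for the norm of `A(z)` -/

noncomputable section

theorem coeff_mul_T (f : ℂ[T;T⁻¹]) (n d : ℤ) :
    (f * LaurentPolynomial.T n).coeff (d + n) = f.coeff d := by
  rw [LaurentPolynomial.T, AddMonoidAlgebra.coeff_mul_single_add, mul_one]

theorem coeff_toLaurent_natCast (q : Polynomial ℂ) (n : ℕ) :
    (Polynomial.toLaurent q).coeff (n : ℤ) = q.coeff n := by
  rw [LaurentPolynomial.coeff_toLaurent]
  exact Finsupp.mapDomain_apply Nat.castEmbedding.injective _ _

open Polynomial in
theorem norm_eval_le_mul_pow (q : ℂ[X]) {n : ℕ} (hq : q.degree < n) {z : ℂ} (hz : 1 ≤ ‖z‖) :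
    ‖q.eval z‖ ≤ (∑ i ∈ Finset.range n, ‖q.coeff i‖) * ‖z‖ ^ n := by
  rcases eq_or_ne q 0 with rfl | hq0
  · simp
  rw [eval_eq_sum_range' ((natDegree_lt_iff_degree_lt hq0).2 hq), Finset.sum_mul]
  refine (norm_sum_le _ _).trans (Finset.sum_le_sum fun i hi => ?_)
  rw [norm_mul, norm_pow]
  exact mul_le_mul_of_nonneg_left (pow_le_pow_right₀ hz (Finset.mem_range.1 hi).le)
    (norm_nonneg _)

open Polynomial in
/-- A Laurent polynomial with a term of positive degree is large at infinity. -/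
theorem exists_one_le_norm_eval₂ {f : ℂ[T;T⁻¹]} {d : ℤ} (hd : 0 < d) (hf : f.coeff d ≠ 0) :
    ∃ R : ℝ, ∀ z : ℂˣ, R ≤ ‖(z : ℂ)‖ → 1 ≤ ‖LaurentPolynomial.eval₂ (RingHom.id ℂ) z f‖ := by
  obtain ⟨n, q, hq⟩ := f.exists_T_pow
  obtain ⟨m, rfl⟩ := Int.eq_ofNat_of_zero_le hd.le
  have hcoeff : q.coeff (m + n) ≠ 0 := by
    rw [← coeff_toLaurent_natCast, hq, Nat.cast_add, coeff_mul_T]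
    exact hf
  have hm : 0 < m := by exact_mod_cast hd
  -- Division by `X ^ n` separates the negative powers, which are bounded for `|z| ≥ 1`, from a
  -- nonconstant polynomial, which tends to infinity.
  have hdeg : 0 < (q /ₘ X ^ n).degree := by
    rw [← natDegree_pos_iff_degree_pos, natDegree_divByMonic _ (monic_X_pow n), natDegree_X_pow]
    have := le_natDegree_of_ne_zero hcoeff
    omega
  have hlim : Tendsto (fun z : ℂ => ‖(q /ₘ X ^ n).eval z‖) (Filter.comap norm atTop) atTop :=
    tendsto_norm_atTop _ hdeg tendsto_comap
  set c := ∑ i ∈ Finset.range n, ‖(q %ₘ X ^ n).coeff i‖ with hc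
  have hev := hlim.eventually_ge_atTop (c + 1)
  rw [eventually_comap, eventually_atTop] at hev
  obtain ⟨R, hR⟩ := hev
  refine ⟨max R 1, fun z hz => ?_⟩
  have h1 := hR ‖(z : ℂ)‖ ((le_max_left _ _).trans hz) z rfl
  have hz1 : 1 ≤ ‖(z : ℂ)‖ := (le_max_right _ _).trans hz
  have hdegr : (q %ₘ X ^ n).degree < n := by
    have := degree_modByMonic_lt q (monic_X_pow (R := ℂ) n)
    rwa [degree_X_pow] at this
  have h2 := norm_eval_le_mul_pow _ hdegr hz1
  have h3 : LaurentPolynomial.eval₂ (RingHom.id ℂ) z f * (z : ℂ) ^ n =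
      (q %ₘ X ^ n).eval (z : ℂ) + (z : ℂ) ^ n * (q /ₘ X ^ n).eval (z : ℂ) := by
    have h4 := congrArg (LaurentPolynomial.eval₂ (RingHom.id ℂ) z) hq
    rw [map_mul, LaurentPolynomial.eval₂_toLaurent, LaurentPolynomial.eval₂_T] at h4
    have h5 := congrArg (eval (z : ℂ)) (modByMonic_add_div q (X ^ n))
    rw [eval_add, eval_mul, eval_pow, eval_X] at h5
    rw [h5]
    simpa [eval₂_id] using h4.symm
  have hzn : 0 < ‖(z : ℂ)‖ ^ n := by positivity
  have h6 : ‖(z : ℂ)‖ ^ n * ‖(q /ₘ X ^ n).eval (z : ℂ)‖ - ‖(q %ₘ X ^ n).eval (z : ℂ)‖ ≤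
      ‖LaurentPolynomial.eval₂ (RingHom.id ℂ) z f‖ * ‖(z : ℂ)‖ ^ n := by
    rw [← norm_pow, ← norm_mul, ← norm_mul, h3, add_comm]
    exact norm_sub_le_norm_add _ _
  refine le_of_mul_le_mul_right ?_ hzn
  nlinarith

variable {k : ℕ} {I J : Fin k → Type} [∀ j, Fintype (I j)] [∀ j, DecidableEq (I j)]
    [∀ j, Fintype (J j)]

omit [∀ j, Fintype (I j)] [∀ j, DecidableEq (I j)] [∀ j, Fintype (J j)] in
theorem kronAt_apply (A : ∀ j, Matrix (J j) (I j) ℂ[T;T⁻¹]) (z : ℂˣ) (x : ∀ j, J j)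
    (y : ∀ j, I j) :
    kronAt A z x y = LaurentPolynomial.eval₂ (RingHom.id ℂ) z (kron A x y) := by
  simp [kronAt, kron, map_prod]

/-- The operator norm of `kronAt A` as a continuous function on `ℂ \ {0}`. -/
theorem exists_continuousOn_opNorm (A : ∀ j, Matrix (J j) (I j) ℂ[T;T⁻¹]) :
    ∃ N : ℂ → ℝ, ContinuousOn N {0}ᶜ ∧ ∀ z : ℂˣ, N z = opNorm (kronAt A z) := by
  choose n q hq using fun x y => (kron A x y).exists_T_pow
  let V : ℂ → Matrix (∀ j, J j) (∀ j, I j) ℂ :=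
    fun z => Matrix.of fun x y => (q x y).eval z * (z ^ n x y)⁻¹
  have hV : ContinuousOn V {0}ᶜ := continuousOn_pi.2 fun x => continuousOn_pi.2 fun y =>
    (q x y).continuous.continuousOn.mul
      (ContinuousOn.inv₀ (continuous_pow _).continuousOn fun z hz => pow_ne_zero _ hz)
  refine ⟨fun z => opNorm (V z), continuous_opNorm.comp_continuousOn hV, fun z => ?_⟩
  have h : V z = kronAt A z := by
    ext x y
    rw [kronAt_apply]
    have h := congrArg (LaurentPolynomial.eval₂ (RingHom.id ℂ) z) (hq x y)
    rw [map_mul, LaurentPolynomial.eval₂_toLaurent, LaurentPolynomial.eval₂_T, zpow_natCast,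
      Units.val_pow_eq_pow_val, Polynomial.eval₂_id] at h
    change (q x y).eval (z : ℂ) * ((z : ℂ) ^ n x y)⁻¹ = _
    rw [← div_eq_mul_inv, div_eq_iff (pow_ne_zero _ z.ne_zero)]
    exact h
  exact congrArg opNorm h

/-- Far out, an entry with a positive power is at least 1 in modulus; on the remaining compact
annulus continuity and nonvanishing suffice. The bound turns an upper bound for the exponent into a
uniform upper bound for the potential on the support. -/
theorem exists_opNorm_kronAt_ge {A : ∀ j, Matrix (J j) (I j) ℂ[T;T⁻¹]}
    (hnz : ∀ z : ℂˣ, kronAt A z ≠ 0)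
    (hpos : ∃ d : ℤ, 0 < d ∧ ∃ x y, (kron A x y).coeff d ≠ 0) {δ : ℝ} (hδ : 0 < δ) :
    ∃ c : ℝ, 0 < c ∧ ∀ z : ℂˣ, δ ≤ ‖(z : ℂ)‖ → c ≤ opNorm (kronAt A z) := by
  obtain ⟨d, hd, x, y, hxy⟩ := hpos
  obtain ⟨R, hR⟩ := exists_one_le_norm_eval₂ hd hxy
  obtain ⟨N, hN, hNA⟩ := exists_continuousOn_opNorm A
  let K : Set ℂ := Metric.closedBall 0 R ∩ {z | δ ≤ ‖z‖}
  have hK : IsCompact K := (isCompact_closedBall 0 R).inter_right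
    (isClosed_le continuous_const continuous_norm)
  have hK0 : K ⊆ {0}ᶜ := by
    rintro z ⟨-, hz⟩ rfl
    exact absurd (show δ ≤ ‖(0 : ℂ)‖ from hz) (by simpa using hδ)
  have hlarge : ∀ z : ℂˣ, R ≤ ‖(z : ℂ)‖ → 1 ≤ opNorm (kronAt A z) := fun z hz =>
    (hR z hz).trans (by rw [← kronAt_apply]; exact norm_apply_le_opNorm _ x y)
  rcases K.eq_empty_or_nonempty with hKe | hKn
  · refine ⟨1, one_pos, fun z hz => hlarge z ?_⟩
    by_contra h
    have : (z : ℂ) ∈ K := ⟨by simpa using (not_le.1 h).le, hz⟩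
    rw [hKe] at this
    exact this
  · obtain ⟨z₀, hz₀, hmin⟩ := hK.exists_isMinOn hKn (hN.mono hK0)
    have hz₀' : z₀ ≠ 0 := hK0 hz₀
    have hpos₀ : 0 < N z₀ := by
      have h := hNA (Units.mk0 z₀ hz₀')
      rw [Units.val_mk0] at h
      rw [h]
      exact lt_of_le_of_ne (opNorm_nonneg _) fun h0 => hnz _ (opNorm_eq_zero.1 h0.symm)
    refine ⟨min 1 (N z₀), lt_min one_pos hpos₀, fun z hz => ?_⟩
    rcases le_total R ‖(z : ℂ)‖ with h | h
    · exact (min_le_left _ _).trans (hlarge z h)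
    · rw [← hNA]
      exact (min_le_right _ _).trans (hmin ⟨by simpa using h, hz⟩)

theorem exists_opNorm_kronAt_le (A : ∀ j, Matrix (J j) (I j) ℂ[T;T⁻¹]) :
    ∃ C : ℝ, ∀ z : ℂˣ, ‖(z : ℂ)‖ = 1 → opNorm (kronAt A z) ≤ C := by
  obtain ⟨N, hN, hNA⟩ := exists_continuousOn_opNorm A
  obtain ⟨C, hC⟩ := (isCompact_sphere (0 : ℂ) 1).bddAbove_image (hN.mono (by
    rintro z hz rfl
    simp at hz))
  refine ⟨C, fun z hz => ?_⟩
  rw [← hNA]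
  exact hC ⟨z, by simpa using hz, rfl⟩

end

/-! ### From probability measures to interpolation formulas -/

noncomputable section

theorem exists_one_sub_le_measureReal_closedBall (σ : Measure ℂ) [IsProbabilityMeasure σ] {τ : ℝ}
    (hτ : 0 < τ) : ∃ R : ℝ, 0 < R ∧ 1 - τ ≤ σ.real (Metric.closedBall 0 R) := by
  have h : Tendsto (fun n : ℕ => σ (Metric.closedBall (0 : ℂ) n)) atTop (𝓝 1) := by
    have h := tendsto_measure_iUnion_atTop (μ := σ)
      (s := fun n : ℕ => Metric.closedBall (0 : ℂ) n)
      (fun m n hmn => Metric.closedBall_subset_closedBall (Nat.cast_le.2 hmn))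
    rwa [Metric.iUnion_closedBall_nat, measure_univ] at h
  have h' : Tendsto (fun n : ℕ => σ.real (Metric.closedBall (0 : ℂ) n)) atTop (𝓝 1) := by
    have := (ENNReal.tendsto_toReal ENNReal.one_ne_top).comp h
    simpa [Measure.real, Function.comp_def] using this
  have h1 : ∀ᶠ n : ℕ in atTop, 1 - τ < σ.real (Metric.closedBall (0 : ℂ) n) :=
    h'.eventually (lt_mem_nhds (by linarith))
  obtain ⟨n, hn, hn0⟩ := (h1.and (eventually_gt_atTop 0)).exists
  exact ⟨n, by exact_mod_cast hn0, hn.le⟩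

/-- Conditioning a probability measure on a large ball changes the potential only slightly. -/
theorem integral_logKernel_cond_le {σ : Measure ℂ} [IsProbabilityMeasure σ] {τ C R : ℝ}
    (hτ : 0 < τ) (hτ2 : τ ≤ 1 / 2) (hC : 0 ≤ C) (hR : 0 < R)
    (hball : 1 - τ ≤ σ.real (Metric.closedBall 0 R)) {z : ℂ} (hz : ‖z‖ ≤ R)
    (hint : Integrable (logKernel z) σ) (hU : ∫ t, logKernel z t ∂σ ≤ C) :
    ∫ t, logKernel z t ∂(ProbabilityTheory.cond σ (Metric.closedBall 0 R)) ≤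
      ∫ t, logKernel z t ∂σ + 2 * τ * (C + 1) := by
  set B := Metric.closedBall (0 : ℂ) R with hB
  have hBm : MeasurableSet B := measurableSet_closedBall
  set s := σ.real B with hs
  have hs1 : s ≤ 1 := measureReal_le_one
  have hs0 : 1 / 2 ≤ s := by linarith
  have hcond : ∫ t, logKernel z t ∂(ProbabilityTheory.cond σ B) =
      s⁻¹ * ∫ t in B, logKernel z t ∂σ := by
    rw [ProbabilityTheory.cond, integral_smul_measure, ENNReal.toReal_inv, smul_eq_mul]
    rfl
  have hadd := integral_add_compl hBm hint
  -- For `t` outside the ball and `z` inside, `|z - t| ≤ 2|t|`, so the kernel is at least `-1`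
  -- there.
  have hcompl : -(1 - s) ≤ ∫ t in Bᶜ, logKernel z t ∂σ := by
    have hconst : ∫ _ in Bᶜ, (-1 : ℝ) ∂σ = -(1 - s) := by
      rw [setIntegral_const, probReal_compl_eq_one_sub hBm, smul_eq_mul]
      ring
    rw [← hconst]
    refine setIntegral_mono_on (integrable_const _) hint.integrableOn hBm.compl fun t ht => ?_
    have htR : R < ‖t‖ := by simpa [hB] using ht
    have h := neg_logKernel_le z (norm_pos_iff.1 (hR.trans htR))
    have h2 : Real.logb 2 (1 + ‖z‖ / ‖t‖) ≤ 1 := by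
      have h3 : ‖z‖ / ‖t‖ ≤ 1 := (div_le_one (hR.trans htR)).2 (hz.trans htR.le)
      rw [Real.logb_le_iff_le_rpow one_lt_two (by positivity)]
      norm_num
      linarith
    linarith
  set U := ∫ t, logKernel z t ∂σ with hUdef
  have h1 : ∫ t in B, logKernel z t ∂σ ≤ U + τ := by linarith
  have hinv : s⁻¹ ≤ 1 + 2 * τ := by
    rw [inv_le_iff_one_le_mul₀ (by linarith)]
    nlinarith
  have hinv1 : 1 ≤ s⁻¹ := (one_le_inv₀ (by linarith)).2 hs1
  rw [hcond]
  calc s⁻¹ * ∫ t in B, logKernel z t ∂σ ≤ s⁻¹ * (U + τ) :=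
        mul_le_mul_of_nonneg_left h1 (by linarith)
    _ ≤ U + 2 * τ * (C + 1) := by
        have h4 : (s⁻¹ - 1) * U ≤ (s⁻¹ - 1) * C :=
          mul_le_mul_of_nonneg_left hU (by linarith)
        have h5 : (s⁻¹ - 1) * C ≤ 2 * τ * C := mul_le_mul_of_nonneg_right (by linarith) hC
        have h6 : s⁻¹ * τ ≤ 2 * τ := mul_le_mul_of_nonneg_right (by linarith) hτ.le
        nlinarith

/-- Sampling: slightly more than `d` points whose discrete potentials are at most `d` times the
potential of the given measure, up to a small error. -/
theorem eventually_exists_finset_sum_logKernel_le {σ : Measure ℂ} [IsProbabilityMeasure σ]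
    {S : Set ℂ} (hS : ∀ᵐ z ∂σ, z ∈ S) {δ : ℝ} (hδ : 0 < δ) (hSδ : ∀ z ∈ S, δ ≤ ‖z‖)
    (hatom : ∀ z ∈ S, σ {z} = 0) (hint : ∀ z ∈ S, Integrable (logKernel z) σ) {C : ℝ}
    (hU : ∀ z ∈ S, ∫ t, logKernel z t ∂σ ≤ C) {ε : ℝ} (hε : 0 < ε) :
    ∀ᶠ d : ℕ in atTop, ∃ T : Finset ℂ, d < T.card ∧ T.card ≤ 4 * (d + 1) ∧ ∀ z ∈ T, z ∈ S ∧
      ∑ t ∈ T.erase z, logKernel z t ≤ d * (∫ t, logKernel z t ∂σ + ε) := by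
  wlog hC : 0 ≤ C generalizing C
  · exact this (fun z hz => (hU z hz).trans (le_max_left C 0)) (le_max_right C 0)
  set τ := min (1 / 2) (ε / (8 * C + 8)) with hτdef
  have hτ : 0 < τ := lt_min (by norm_num) (by positivity)
  have hτ2 : τ ≤ 1 / 2 := min_le_left _ _
  have hτε : τ * (8 * C + 8) ≤ ε := by
    rw [← le_div_iff₀ (by positivity)]
    exact min_le_right _ _
  obtain ⟨R, hR, hball⟩ := exists_one_sub_le_measureReal_closedBall σ hτ
  have hBm : MeasurableSet (Metric.closedBall (0 : ℂ) R) := measurableSet_closedBall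
  have hB0 : σ (Metric.closedBall (0 : ℂ) R) ≠ 0 := by
    intro h0
    rw [Measure.real, h0, ENNReal.toReal_zero] at hball
    linarith
  -- The support of `σ` may be unbounded, but sampling needs a uniform lower bound for the kernel,
  -- hence bounded nodes.
  set μ := ProbabilityTheory.cond σ (Metric.closedBall (0 : ℂ) R) with hμ
  have : IsProbabilityMeasure μ := ProbabilityTheory.cond_isProbabilityMeasure hB0
  have hac : μ ≪ σ := ProbabilityTheory.cond_absolutelyContinuous
  have hp : ∀ᵐ z ∂μ, z ∈ S ∧ ‖z‖ ≤ R := by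
    filter_upwards [hac.ae_le hS, ProbabilityTheory.ae_cond_mem hBm] with z h1 h2
    exact ⟨h1, by simpa using h2⟩
  have hintμ : ∀ z ∈ S, Integrable (logKernel z) μ := fun z hz =>
    (hint z hz).integrableOn.smul_measure (ENNReal.inv_ne_top.2 hB0)
  have hsample := eventually_exists_finset (μ := μ) (p := fun z => z ∈ S ∧ ‖z‖ ≤ R)
    (H := Real.logb 2 (1 + R / δ)) (ε := τ) hp
    (Real.logb_nonneg one_lt_two (by have : 0 < R / δ := by positivity
                                     linarith))
    (fun z t hz ht => by
      have ht0 : 0 < ‖t‖ := hδ.trans_le (hSδ t ht.1)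
      refine (neg_logKernel_le z (norm_pos_iff.1 ht0)).trans ?_
      refine Real.logb_le_logb_of_le one_lt_two (by positivity) ?_
      have h1 : ‖z‖ / ‖t‖ ≤ R / δ := div_le_div₀ hR.le hz.2 hδ (hSδ t ht.1)
      linarith)
    (fun z => hac (by
      by_cases hz : z ∈ S
      · exact hatom z hz
      · exact measure_mono_null (by simpa using hz) (ae_iff.1 hS)))
    (hp.mono fun z hz => hintμ z hz.1) hτ
  -- With this sample size at least `d + 1` nodes survive the loss of a fraction `τ`, as
  -- interpolation in degree `d` requires.
  have hDlim : Tendsto (fun d : ℕ => ⌈((d : ℝ) + 1) / (1 - τ)⌉₊) atTop atTop := by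
    refine tendsto_atTop_mono (fun d => ?_) tendsto_id
    have h1 : (d : ℝ) ≤ ((d : ℝ) + 1) / (1 - τ) := by
      rw [le_div_iff₀ (by linarith)]
      nlinarith [(Nat.cast_nonneg d : (0 : ℝ) ≤ d)]
    exact_mod_cast h1.trans (Nat.le_ceil _)
  filter_upwards [hDlim.eventually hsample, eventually_ge_atTop ⌈3 / τ⌉₊] with d hd hdτ
  obtain ⟨T, hT1, hT2, hT⟩ := hd
  set D := ⌈((d : ℝ) + 1) / (1 - τ)⌉₊ with hD
  have hd0 : (0 : ℝ) ≤ d := Nat.cast_nonneg d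
  have hD1 : ((d : ℝ) + 1) / (1 - τ) ≤ D := Nat.le_ceil _
  have hD2 : (D : ℝ) < ((d : ℝ) + 1) / (1 - τ) + 1 := Nat.ceil_lt_add_one (by
    have : 0 < 1 - τ := by linarith
    positivity)
  have hinv : ((d : ℝ) + 1) / (1 - τ) ≤ (d + 1) * (1 + 2 * τ) := by
    rw [div_le_iff₀ (by linarith)]
    nlinarith [mul_nonneg hd0 (mul_nonneg hτ.le (by linarith : 0 ≤ 1 - 2 * τ)),
      mul_nonneg hτ.le (by linarith : 0 ≤ 1 - 2 * τ)]
  have h3 : 3 ≤ τ * d := by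
    have := Nat.ceil_le.1 hdτ
    rwa [div_le_iff₀ hτ, mul_comm] at this
  have hD3 : (D : ℝ) ≤ (1 + 3 * τ) * d := by nlinarith
  have hD4 : (d : ℝ) ≤ D := by
    refine le_trans ?_ hD1
    rw [le_div_iff₀ (by linarith)]
    nlinarith
  refine ⟨T, ?_, ?_, fun z hz => ⟨(hT z hz).1.1, (hT z hz).2.trans ?_⟩⟩
  · have h4 : (d : ℝ) + 1 ≤ T.card := by
      rw [div_le_iff₀ (by linarith)] at hD1
      linarith
    exact_mod_cast h4
  · have h4 : (T.card : ℝ) ≤ 4 * (d + 1) := by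
      have h5 : (T.card : ℝ) ≤ D + 1 := by exact_mod_cast hT2
      nlinarith
    exact_mod_cast h4
  · have hzS := (hT z hz).1.1
    have hI := integral_logKernel_cond_le hτ hτ2 hC hR hball (hT z hz).1.2 (hint z hzS) (hU z hzS)
    rw [← hμ] at hI
    have hUz := hU z hzS
    set U := ∫ t, logKernel z t ∂σ
    calc (D : ℝ) * (∫ x, logKernel z x ∂μ + τ) ≤ D * (U + τ * (2 * C + 3)) :=
          mul_le_mul_of_nonneg_left (by linarith) (by positivity)
      _ = d * U + (D - d) * U + D * (τ * (2 * C + 3)) := by ring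
      _ ≤ d * U + (3 * τ * d) * C + ((5 / 2) * d) * (τ * (2 * C + 3)) := by
          have h6 : ((D : ℝ) - d) * U ≤ (3 * τ * d) * C :=
            (mul_le_mul_of_nonneg_left hUz (by linarith)).trans
              (mul_le_mul_of_nonneg_right (by linarith) hC)
          have h7 : (D : ℝ) * (τ * (2 * C + 3)) ≤ ((5 / 2) * d) * (τ * (2 * C + 3)) :=
            mul_le_mul_of_nonneg_right (by nlinarith) (by positivity)
          linarith
      _ = d * (U + τ * (8 * C + 15 / 2)) := by ring
      _ ≤ d * (U + ε) := by
          refine mul_le_mul_of_nonneg_left ?_ hd0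
          nlinarith

theorem eventually_mul_add_one_le_rpow (C : ℝ) {ε : ℝ} (hε : 0 < ε) :
    ∀ᶠ n : ℕ in atTop, C * (n + 1) ≤ (2 : ℝ) ^ (n * ε) := by
  have h1 : (1 : ℝ) < 2 ^ ε := Real.one_lt_rpow one_lt_two hε
  have h2 := (isLittleO_pow_const_const_pow_of_one_lt (R := ℝ) 1 h1).def
    (c := (2 * (|C| + 1))⁻¹) (by positivity)
  filter_upwards [h2, eventually_ge_atTop 1] with n hn hn1
  have hn1' : (1 : ℝ) ≤ n := by exact_mod_cast hn1
  rw [pow_one, Real.norm_of_nonneg (by positivity), Real.norm_of_nonneg (by positivity),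
    ← Real.rpow_natCast, ← Real.rpow_mul zero_le_two, mul_comm ε, inv_mul_eq_div,
    le_div_iff₀ (by positivity)] at hn
  nlinarith [le_abs_self C, abs_nonneg C]

variable {k : ℕ} {I J : Fin k → Type} [∀ j, Fintype (I j)] [∀ j, DecidableEq (I j)]
    [∀ j, Fintype (J j)]

/-- The value at `0` of polynomials of degree at most `n * e` can be interpolated from few nonzero
points, the cost of which, measured with the weight `‖A(z)‖ ^ n`, is at most `2 ^ (n L + o(n))`. -/
def Interpolates (A : ∀ j, Matrix (J j) (I j) ℂ[T;T⁻¹]) (e : ℕ) (L : ℝ) : Prop :=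
  ∀ ε : ℝ, 0 < ε → ∀ᶠ n : ℕ in atTop, ∃ (X : Type) (_ : Fintype X) (z : X → ℂˣ) (w : X → ℂ),
    Fintype.card X ≤ 4 * (n * e + 1) ∧
    (∀ f : Polynomial ℂ, f.natDegree ≤ n * e → ∑ i, w i * f.eval (z i : ℂ) = f.eval 0) ∧
    ∑ i, ‖w i‖ * opNorm (kronAt A (z i)) ^ n ≤ (2 : ℝ) ^ (n * (L + ε))

theorem Interpolates.of_forall_add {A : ∀ j, Matrix (J j) (I j) ℂ[T;T⁻¹]} {e : ℕ} {L : ℝ}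
    (h : ∀ ε : ℝ, 0 < ε → Interpolates A e (L + ε)) : Interpolates A e L := by
  intro ε hε
  filter_upwards [h (ε / 2) (half_pos hε) (ε / 2) (half_pos hε)] with n hn
  simpa only [add_assoc, add_halves] using hn

theorem exponentAt_eq {A : ∀ j, Matrix (J j) (I j) ℂ[T;T⁻¹]} (hnz : ∀ z : ℂˣ, kronAt A z ≠ 0)
    (e : ℕ) (σ : Measure ℂ) (z : ℂˣ) : exponentAt A e σ z =
      (Real.logb 2 (opNorm (kronAt A z)) : ℝ) + (e : EReal) * potential σ z := by
  have hpos : 0 < opNorm (kronAt A z) :=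
    lt_of_le_of_ne (opNorm_nonneg _) fun h0 => hnz _ (opNorm_eq_zero.1 h0.symm)
  rw [exponentAt, dif_neg z.ne_zero, Units.mk0_val, log2_ofReal hpos]

theorem interpolates_zero {A : ∀ j, Matrix (J j) (I j) ℂ[T;T⁻¹]} {L : ℝ} (z : ℂˣ)
    (hL : opNorm (kronAt A z) ≤ 2 ^ L) : Interpolates A 0 L := by
  intro ε hε
  refine .of_forall fun n => ⟨Unit, inferInstance, fun _ => z, fun _ => 1, by simp, ?_, ?_⟩
  · intro f hf
    rw [Polynomial.eq_C_of_natDegree_le_zero (p := f) (by simpa using hf)]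
    simp
  · have h1 : opNorm (kronAt A z) ^ n ≤ (2 : ℝ) ^ (n * L) := by
      rw [mul_comm, Real.rpow_mul_natCast zero_le_two]
      exact pow_le_pow_left₀ (opNorm_nonneg _) hL n
    have h2 : (2 : ℝ) ^ (n * L) ≤ 2 ^ (n * (L + ε)) :=
      Real.rpow_le_rpow_of_exponent_le one_le_two
        (mul_le_mul_of_nonneg_left (by linarith) (Nat.cast_nonneg n))
    simpa using h1.trans h2

/-- The nodes are sampled from `σ` and the weights are those of Lagrange. Each term is then at most
`2 ^ (n * (L + ε / 2))`, and the linear number of terms is absorbed by the other `ε / 2`. -/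
theorem interpolates_of_measure {A : ∀ j, Matrix (J j) (I j) ℂ[T;T⁻¹]}
    (hnz : ∀ z : ℂˣ, kronAt A z ≠ 0)
    (hpos : ∃ d : ℤ, 0 < d ∧ ∃ x y, (kron A x y).coeff d ≠ 0) {e : ℕ} {σ : Measure ℂ}
    [IsProbabilityMeasure σ] {L : ℝ} (hL : ∀ z ∈ σ.support, exponentAt A e σ z ≤ L) :
    Interpolates A e L := by
  have hF : ∀ z : ℂˣ, 0 < opNorm (kronAt A z) := fun z =>
    lt_of_le_of_ne (opNorm_nonneg _) fun h0 => hnz _ (opNorm_eq_zero.1 h0.symm)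
  -- The value `∞` at the origin keeps 0 out of the support, which is closed and hence at positive
  -- distance from 0.
  have h0 : (0 : ℂ) ∉ σ.support := by
    intro h
    have := hL 0 h
    rw [exponentAt, dif_pos rfl, top_le_iff] at this
    exact EReal.coe_ne_top _ this
  obtain ⟨δ, hδ, hSδ⟩ : ∃ δ : ℝ, 0 < δ ∧ ∀ z ∈ σ.support, δ ≤ ‖z‖ := by
    obtain ⟨δ, hδ, hsub⟩ := Metric.isOpen_iff.1 Measure.isClosed_support.isOpen_compl 0 h0
    refine ⟨δ, hδ, fun z hz => ?_⟩
    by_contra hlt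
    exact hsub (by simpa using not_le.1 hlt) hz
  have hne : ∀ z ∈ σ.support, z ≠ 0 := fun z hz => norm_pos_iff.1 (hδ.trans_le (hSδ z hz))
  have hS : ∀ᵐ z ∂σ, z ∈ σ.support := Measure.support_mem_ae
  -- For `e = 0` the potential may be infinite without affecting the exponent, so nothing can be
  -- inferred about it; but then one node is enough.
  rcases Nat.eq_zero_or_pos e with rfl | he
  · obtain ⟨z, hz⟩ : σ.support.Nonempty := Measure.nonempty_support (IsProbabilityMeasure.ne_zero σ)
    refine interpolates_zero (Units.mk0 z (hne z hz)) ?_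
    have h := hL z hz
    rw [← Units.val_mk0 (hne z hz), exponentAt_eq hnz, Nat.cast_zero, zero_mul, add_zero,
      EReal.coe_le_coe_iff] at h
    exact (Real.logb_le_iff_le_rpow one_lt_two (hF _)).1 h
  have he' : (0 : ℝ) < e := by exact_mod_cast he
  have hδσ : ∀ᵐ t ∂σ, δ ≤ ‖t‖ := hS.mono hSδ
  have key : ∀ z : ℂˣ, (z : ℂ) ∈ σ.support → σ {(z : ℂ)} = 0 ∧ Integrable (logKernel z) σ ∧
      Real.logb 2 (opNorm (kronAt A z)) + e * ∫ t, logKernel z t ∂σ ≤ L := by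
    intro z hz
    have h := hL z hz
    rw [exponentAt_eq hnz] at h
    have hpot : potential σ z ≠ ⊤ := by
      intro hp
      rw [hp, EReal.mul_top_of_pos (by exact_mod_cast he), EReal.coe_add_top, top_le_iff] at h
      exact EReal.coe_ne_top _ h
    obtain ⟨h1, h2, h3⟩ := potential_eq_integral hδ hδσ hpot
    refine ⟨h1, h2, ?_⟩
    rw [h3] at h
    exact_mod_cast h
  obtain ⟨c, hc, hcF⟩ := exists_opNorm_kronAt_ge hnz hpos hδ
  have hU : ∀ z ∈ σ.support, ∫ t, logKernel z t ∂σ ≤ (L - Real.logb 2 c) / e := by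
    intro z hz
    have h := (key (Units.mk0 z (hne z hz)) hz).2.2
    have h1 : Real.logb 2 c ≤ Real.logb 2 (opNorm (kronAt A (Units.mk0 z (hne z hz)))) :=
      Real.logb_le_logb_of_le one_lt_two hc (hcF _ (hSδ z hz))
    rw [Units.val_mk0] at h
    rw [le_div_iff₀ he', mul_comm]
    linarith
  intro ε hε
  have hsample := eventually_exists_finset_sum_logKernel_le hS hδ hSδ
    (fun z hz => (key (Units.mk0 z (hne z hz)) hz).1)
    (fun z hz => (key (Units.mk0 z (hne z hz)) hz).2.1) hU (ε := ε / (2 * e)) (by positivity)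
  have hmul : Tendsto (fun n : ℕ => n * e) atTop atTop :=
    tendsto_atTop_mono (fun n => Nat.le_mul_of_pos_right n he) tendsto_id
  filter_upwards [hmul.eventually hsample,
    eventually_mul_add_one_le_rpow (4 * e) (half_pos hε)] with n hn hlin
  obtain ⟨T, hT1, hT2, hT⟩ := hn
  have hT0 : ∀ z ∈ T, z ≠ 0 := fun z hz => hne z (hT z hz).1
  refine ⟨T, inferInstance, fun z => Units.mk0 z (hT0 z z.2),
    fun z => ∏ t ∈ T.erase z, t / (t - z), by simpa using hT2, fun f hf => ?_, ?_⟩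
  · exact sum_prod_div_mul_eval (hf.trans_lt hT1)
  · have hterm : ∀ z : T, ‖∏ t ∈ T.erase (z : ℂ), t / (t - z)‖ *
        opNorm (kronAt A (Units.mk0 (z : ℂ) (hT0 z z.2))) ^ n ≤ (2 : ℝ) ^ (n * (L + ε / 2)) := by
      intro z
      have hk := (key (Units.mk0 (z : ℂ) (hT0 z z.2)) (hT z z.2).1).2.2
      have hs := (hT z z.2).2
      set F := opNorm (kronAt A (Units.mk0 (z : ℂ) (hT0 z z.2))) with hFdef
      have hF0 : 0 < F := hF _
      have hFn : F ^ n = (2 : ℝ) ^ (n * Real.logb 2 F) := by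
        rw [mul_comm, Real.rpow_mul_natCast zero_le_two,
          Real.rpow_logb two_pos (by norm_num) hF0]
      rw [norm_prod_div_eq hT0, hFn, ← Real.rpow_add two_pos]
      refine Real.rpow_le_rpow_of_exponent_le one_le_two ?_
      rw [Units.val_mk0] at hk
      have hn0 : (0 : ℝ) ≤ n := Nat.cast_nonneg n
      push_cast at hs
      have h4 : (n : ℝ) * e * (∫ t, logKernel z t ∂σ + ε / (2 * e)) =
          n * (e * ∫ t, logKernel z t ∂σ) + n * (ε / 2) := by
        field_simp
      nlinarith [mul_le_mul_of_nonneg_left hk hn0]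
    calc _ ≤ ∑ _z : T, (2 : ℝ) ^ (n * (L + ε / 2)) := Finset.sum_le_sum fun z _ => hterm z
      _ = T.card * (2 : ℝ) ^ (n * (L + ε / 2)) := by simp
      _ ≤ (2 : ℝ) ^ (n * (ε / 2)) * (2 : ℝ) ^ (n * (L + ε / 2)) := by
          refine mul_le_mul_of_nonneg_right (le_trans ?_ hlin) (by positivity)
          have h5 : (T.card : ℝ) ≤ 4 * (n * e + 1) := by exact_mod_cast hT2
          have h6 : (1 : ℝ) ≤ e := by exact_mod_cast he
          nlinarith
      _ = (2 : ℝ) ^ (n * (L + ε)) := by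
          rw [← Real.rpow_add two_pos]
          congr 1
          ring

/-- Interpolation in roots of unity. -/
theorem exists_interpolates (A : ∀ j, Matrix (J j) (I j) ℂ[T;T⁻¹]) (e : ℕ) :
    ∃ L : ℝ, Interpolates A e L := by
  obtain ⟨C, hC⟩ := exists_opNorm_kronAt_le A
  have hC1 : 0 < max C 1 := lt_max_of_lt_right one_pos
  -- Averaging over the `(n * e + 1)`-th roots of unity kills the monomials of degrees `1` to `n *
  -- e`. The weights have total modulus 1, so the cost is at most `max C 1 ^ n`; the maximum with 1
  -- ensures positivity for the logarithm.
  refine ⟨Real.logb 2 (max C 1), fun ε hε => .of_forall fun n => ?_⟩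
  set d := n * e with hd
  have hζ := Complex.isPrimitiveRoot_exp (d + 1) (Nat.succ_ne_zero d)
  set ζ := Complex.exp (2 * Real.pi * Complex.I / ((d + 1 : ℕ) : ℂ)) with hζdef
  have hζ0 : ζ ≠ 0 := Complex.exp_ne_zero _
  have hd1 : ((d : ℂ) + 1) ≠ 0 := by exact_mod_cast Nat.succ_ne_zero d
  refine ⟨Fin (d + 1), inferInstance, fun i => Units.mk0 (ζ ^ (i : ℕ)) (pow_ne_zero _ hζ0),
    fun _ => ((d : ℂ) + 1)⁻¹, by simp, fun f hf => ?_, ?_⟩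
  · simp only [Units.val_mk0]
    rw [← Finset.mul_sum, inv_mul_eq_iff_eq_mul₀ hd1]
    simp_rw [Polynomial.eval_eq_sum_range' (Nat.lt_succ_of_le hf)]
    rw [Finset.sum_comm]
    have h1 : ∀ m ∈ Finset.range (d + 1), ∑ i : Fin (d + 1), f.coeff m * (ζ ^ (i : ℕ)) ^ m =
        f.coeff m * if m = 0 then ((d : ℂ) + 1) else 0 := by
      intro m hm
      rw [← Finset.mul_sum]
      congr 1
      rw [Fin.sum_univ_eq_sum_range (fun i => (ζ ^ i) ^ m)]
      split_ifs with hm0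
      · simp [hm0]
      · simp_rw [← pow_mul, mul_comm _ m, pow_mul ζ m]
        have hne : ζ ^ m ≠ 1 := hζ.pow_ne_one_of_pos_of_lt hm0 (Finset.mem_range.1 hm)
        rw [geom_sum_eq hne, ← pow_mul, mul_comm, pow_mul, hζ.pow_eq_one]
        simp
    rw [Finset.sum_congr rfl h1]
    simp [Finset.sum_range_succ']
    ring
  · have hterm : ∀ i : Fin (d + 1),
        opNorm (kronAt A (Units.mk0 (ζ ^ (i : ℕ)) (pow_ne_zero _ hζ0))) ^ n ≤ max C 1 ^ n := by
      intro i
      refine pow_le_pow_left₀ (opNorm_nonneg _) ((hC _ ?_).trans (le_max_left _ _)) n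
      rw [Units.val_mk0, norm_pow, hζ.norm'_eq_one (Nat.succ_ne_zero d), one_pow]
    calc _ ≤ ∑ _i : Fin (d + 1), ‖((d : ℂ) + 1)⁻¹‖ * max C 1 ^ n :=
          Finset.sum_le_sum fun i _ => mul_le_mul_of_nonneg_left (hterm i) (norm_nonneg _)
      _ = max C 1 ^ n := by
          have h2 : ‖(d : ℂ) + 1‖ = d + 1 := by
            rw [← Nat.cast_add_one, Complex.norm_natCast, Nat.cast_add_one]
          rw [Finset.sum_const, Finset.card_univ, Fintype.card_fin, nsmul_eq_mul, norm_inv, h2]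
          push_cast
          field_simp
      _ = (2 : ℝ) ^ (n * Real.logb 2 (max C 1)) := by
          rw [mul_comm, Real.rpow_mul_natCast zero_le_two,
            Real.rpow_logb two_pos (by norm_num) hC1]
      _ ≤ _ := Real.rpow_le_rpow_of_exponent_le one_le_two
          (mul_le_mul_of_nonneg_left (by linarith) (Nat.cast_nonneg n))

end

/-! ### Asymptotic rate and exponent -/

noncomputable section

theorem eventually_log_succ_le (e : ℕ) {ε : ℝ} (hε : 0 < ε) :
    ∀ᶠ N : ℕ in atTop, ((Nat.log 2 (4 * (N * e + 1)) + 1 : ℕ) : ℝ) ≤ ε * N := by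
  filter_upwards [eventually_mul_add_one_le_rpow (8 * (e + 1)) hε] with N hN
  have h1 : 2 ^ Nat.log 2 (4 * (N * e + 1)) ≤ 4 * (N * e + 1) :=
    Nat.pow_log_le_self 2 (by positivity)
  have h2 : (2 : ℝ) ^ (Nat.log 2 (4 * (N * e + 1)) + 1) ≤ 8 * (e + 1) * (N + 1) := by
    have h3 : (2 : ℝ) ^ Nat.log 2 (4 * (N * e + 1)) ≤ 4 * (N * e + 1) := by exact_mod_cast h1
    have h4 : (0 : ℝ) ≤ N := Nat.cast_nonneg N
    have h5 : (0 : ℝ) ≤ e := Nat.cast_nonneg e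
    rw [pow_succ]
    nlinarith
  have h6 := h2.trans hN
  rw [← Real.rpow_natCast, Real.rpow_le_rpow_left_iff one_lt_two] at h6
  exact h6.trans_eq (mul_comm _ _)

/-- Diagonal choice: if the exponent `r + ε` is achieved eventually for every `ε > 0`, then so is
`r + o(1)`. -/
theorem exists_sequence_of_forall_eventually {P : ℕ → ℕ → ℝ → Prop} {m₀ : ℕ → ℕ} {r : ℝ}
    (h₀ : ∀ N, ∃ m p, 0 < p ∧ P N m p)
    (h : ∀ ε : ℝ, 0 < ε → ∀ᶠ N : ℕ in atTop, ∃ p, (2 : ℝ) ^ (-((r + ε) * N)) ≤ p ∧ P N (m₀ N) p) :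
    ∃ (m : ℕ → ℕ) (p : ℕ → ℝ) (δ : ℕ → ℝ), (∀ᶠ N in atTop, m N = m₀ N) ∧
      Tendsto (fun N : ℕ => δ N / N) atTop (𝓝 0) ∧
      ∀ N : ℕ, (2 : ℝ) ^ (-(r * N) + δ N) ≤ p N ∧ P N (m N) (p N) := by
  -- The errors available at `N`. An error within `1 / (N + 1)` of the infimum is chosen; every
  -- fixed `ε > 0` eventually belongs to `E N`, so the chosen errors tend to 0.
  let E : ℕ → Set ℝ := fun N => {ε | 0 < ε ∧ ∃ p, (2 : ℝ) ^ (-((r + ε) * N)) ≤ p ∧ P N (m₀ N) p}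
  have hE : ∀ ε : ℝ, 0 < ε → ∀ᶠ N in atTop, ε ∈ E N := fun ε hε =>
    (h ε hε).mono fun N hN => ⟨hε, hN⟩
  have hbdd : ∀ N, BddBelow (E N) := fun N => ⟨0, fun ε hε => hε.1.le⟩
  have hchoice : ∀ N : ℕ, ∃ (m : ℕ) (p δ : ℝ), (2 : ℝ) ^ (-(r * N) + δ) ≤ p ∧ P N m p ∧
      ((E N).Nonempty → m = m₀ N ∧
        ∃ ε, 0 < ε ∧ ε < sInf (E N) + 1 / ((N : ℝ) + 1) ∧ δ = -ε * N) := by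
    intro N
    by_cases hN : (E N).Nonempty
    · obtain ⟨ε, ⟨hε, p, hp, hP⟩, hlt⟩ := exists_lt_of_csInf_lt hN
        (lt_add_of_pos_right (sInf (E N)) (Nat.one_div_pos_of_nat (α := ℝ) (n := N)))
      refine ⟨m₀ N, p, -ε * N, ?_, hP, fun _ => ⟨rfl, ε, hε, hlt, rfl⟩⟩
      convert hp using 2
      ring
    · obtain ⟨m, p, hp, hP⟩ := h₀ N
      -- Only finitely many `N` have no available error; there `δ` is whatever makes the bound an
      -- equality.
      refine ⟨m, p, Real.logb 2 p + r * N, ?_, hP, fun h => absurd h hN⟩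
      rw [show -(r * (N : ℝ)) + (Real.logb 2 p + r * N) = Real.logb 2 p by ring,
        Real.rpow_logb two_pos (by norm_num) hp]
  choose m p δ h1 h2 h3 using hchoice
  have hne : ∀ᶠ N in atTop, (E N).Nonempty := (hE 1 one_pos).mono fun N hN => ⟨1, hN⟩
  refine ⟨m, p, δ, hne.mono fun N hN => (h3 N hN).1, ?_, fun N => ⟨h1 N, h2 N⟩⟩
  rw [Metric.tendsto_nhds]
  intro ε hε
  have hlim : ∀ᶠ N : ℕ in atTop, 1 / ((N : ℝ) + 1) < ε / 2 :=
    tendsto_one_div_add_atTop_nhds_zero_nat.eventually (gt_mem_nhds (half_pos hε))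
  filter_upwards [hne, hE (ε / 2) (half_pos hε), hlim, eventually_gt_atTop 0] with N hN hN2 hN3 hN0
  obtain ⟨-, ε', h4, h5, h6⟩ := h3 N hN
  have h7 : sInf (E N) ≤ ε / 2 := csInf_le (hbdd N) hN2
  have hN0' : (N : ℝ) ≠ 0 := by exact_mod_cast hN0.ne'
  rw [h6, mul_div_cancel_right₀ _ hN0', Real.dist_eq, sub_zero, abs_neg, abs_of_pos h4]
  linarith

variable {k : ℕ} {I J : Fin k → Type} [∀ j, Fintype (I j)] [∀ j, DecidableEq (I j)]
    [∀ j, Fintype (J j)] [∀ j, DecidableEq (J j)]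

/-- A fallback for the small `N` at which the main protocol is not yet available: project every copy
onto a basis vector with nonzero amplitude. -/
theorem exists_LOCC_tensorPow_zero (hk : 0 < k) {ψ : Tensor I} (hψ : ψ ≠ 0) (φ : Tensor J)
    (N : ℕ) : ∃ p : ℝ, 0 < p ∧ LOCC (tensorPow φ 0) (tensorPow ψ N) p := by
  obtain ⟨x, hx⟩ := Function.ne_iff.1 hψ
  set c := tensorPow ψ N (fun j _ => x j) with hc
  have hc0 : c ≠ 0 := by
    rw [hc]
    exact Finset.prod_ne_zero_iff.2 fun a _ => hx
  let t : Fin k → ℂ := fun j => if j = ⟨0, hk⟩ then c⁻¹ else 1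
  have ht : ∏ j, t j = c⁻¹ := by simp [t]
  let B : ∀ j, Matrix (Fin 0 → J j) (Fin N → I j) ℂ :=
    fun j => Matrix.of fun _ y => if y = fun _ => x j then t j else 0
  have hB : kron B *ᵥ tensorPow ψ N = tensorPow φ 0 := by
    ext u
    rw [show kron B *ᵥ tensorPow ψ N = _ from
      funext fun u => kron_select_mulVec (fun j _ => fun _ => x j) t (tensorPow ψ N) u, ht]
    rw [← hc, inv_mul_cancel₀ hc0]
    simp [tensorPow]
  refine ⟨_, ?_, LOCC.of_kron_mulVec hk (β := fun j => opNorm (B j) + 1)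
    (fun j => by have := opNorm_nonneg (B j); linarith) (fun j => by linarith) hB⟩
  have : 0 < ∏ j, (opNorm (B j) + 1) :=
    Finset.prod_pos fun j _ => by have := opNorm_nonneg (B j); linarith
  positivity

/-- Of `N` copies, `ℓ N * (k * k) = O(log N)` provide the GHZ states and the rest are transformed,
so the rate is 1. The factor `C ^ (ℓ N + 1)` is polynomial in `N` and does not affect the exponent.
-/
theorem IsDegeneration.asymptoticallyTransforms (hk : 0 < k) {ψ : Tensor I} (hψ : ψ ≠ 0)
    {φ : Tensor J} (hφ : φ ≠ 0) {A : ∀ j, Matrix (J j) (I j) ℂ[T;T⁻¹]} {e : ℕ}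
    (hdeg : IsDegeneration ψ φ A e) (hnz : ∀ z : ℂˣ, kronAt A z ≠ 0) {L : ℝ}
    (hL : Interpolates A e L) : AsymptoticallyTransforms ψ φ 1 (2 * L) := by
  obtain ⟨C, hC, hprot⟩ := hdeg.exists_protocol hk hψ hφ hnz
  set ℓ : ℕ → ℕ := fun N => Nat.log 2 (4 * (N * e + 1)) + 1 with hℓ
  have hℓsmall : ∀ ε : ℝ, 0 < ε → ∀ᶠ N : ℕ in atTop, (ℓ N : ℝ) ≤ ε * N :=
    fun ε hε => eventually_log_succ_le e hε
  have hsub : ∀ᶠ N : ℕ in atTop, 2 * (ℓ N * (k * k)) ≤ N := by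
    have hk' : (0 : ℝ) < 2 * (k * k) := by positivity
    filter_upwards [hℓsmall (2 * (k * k) : ℝ)⁻¹ (by positivity)] with N hN
    rw [inv_mul_eq_div, le_div_iff₀ hk'] at hN
    have : ((2 * (ℓ N * (k * k)) : ℕ) : ℝ) ≤ N := by
      push_cast
      linarith
    exact_mod_cast this
  have hlim : Tendsto (fun N => N - ℓ N * (k * k)) atTop atTop := by
    rw [tendsto_atTop]
    intro b
    filter_upwards [hsub, eventually_ge_atTop (2 * b)] with N h1 h2
    omega
  obtain ⟨m, p, δ, hm, hδ, hp⟩ := exists_sequence_of_forall_eventually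
    (P := fun N m p => LOCC (tensorPow φ m) (tensorPow ψ N) p)
    (m₀ := fun N => N - ℓ N * (k * k)) (r := 2 * L)
    (fun N => ⟨0, exists_LOCC_tensorPow_zero hk hψ φ N⟩) (by
      intro ε hε
      set c := Real.logb 2 C with hc
      have hc0 : 0 ≤ c := Real.logb_nonneg one_lt_two hC
      -- Collects the coefficients of `ℓ N` in the exponent: `2 * c` from `C ^ (ℓ N + 1)`, using `1
      -- ≤ ℓ N`, and the second term from replacing `n` by `N`. With `ℓ N * a ≤ 3 * ε / 8 * N` and
      -- the interpolation error `ε / 8`, the loss is at most `ε / 2` before squaring.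
      set a := 2 * c + k * k * |L + ε / 8| + 1 with ha
      have ha0 : 0 < a := by positivity
      filter_upwards [hsub, hlim.eventually (hL (ε / 8) (by positivity)),
        hℓsmall (3 * ε / 8 / a) (by positivity)] with N hN hX hℓN
      set n := N - ℓ N * (k * k) with hn
      have hnN : n + ℓ N * (k * k) = N := by omega
      obtain ⟨X, _, z, w, hcard, hint, hM⟩ := hX
      have hcard' : Fintype.card X ≤ 2 ^ ℓ N := by
        refine hcard.trans (le_trans ?_ (Nat.lt_pow_succ_log_self one_lt_two _).le)
        have : n ≤ N := Nat.sub_le _ _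
        gcongr
      obtain ⟨p, hp, hLOCC⟩ := hprot n (ℓ N) X z w _ hcard' hint hM
      rw [hnN] at hLOCC
      refine ⟨p, le_trans ?_ hp, hLOCC⟩
      have hCpow : C ^ (ℓ N + 1) = (2 : ℝ) ^ (c * (ℓ N + 1)) := by
        rw [← Nat.cast_add_one, Real.rpow_mul_natCast zero_le_two,
          Real.rpow_logb two_pos (by norm_num) (by linarith)]
      rw [hCpow, ← Real.rpow_add two_pos, ← Real.rpow_neg zero_le_two,
        ← Real.rpow_mul_natCast zero_le_two]
      refine Real.rpow_le_rpow_of_exponent_le one_le_two ?_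
      have hℓ1 : (1 : ℝ) ≤ ℓ N := by simp [hℓ]
      have hnN' : (n : ℝ) + ℓ N * (k * k) = N := by exact_mod_cast hnN
      have h1 : (ℓ N : ℝ) * a ≤ 3 * ε / 8 * N := by
        rw [div_mul_eq_mul_div, le_div_iff₀ ha0] at hℓN
        exact hℓN
      have h2 : -(ℓ N * (k * k) * (L + ε / 8)) ≤ ℓ N * (k * k) * |L + ε / 8| := by
        rw [← mul_neg]
        exact mul_le_mul_of_nonneg_left (neg_le_abs _) (by positivity)
      have h3 : c * (ℓ N + 1) ≤ 2 * c * ℓ N := by nlinarith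
      have h4 : (n : ℝ) * (L + ε / 8) = N * (L + ε / 8) - ℓ N * (k * k) * (L + ε / 8) := by
        rw [← hnN']
        ring
      rw [h4]
      push_cast
      rw [ha] at h1
      nlinarith)
  refine ⟨m, p, δ, ?_, hδ, hp⟩
  have hℓlim : Tendsto (fun N : ℕ => (ℓ N : ℝ) / N) atTop (𝓝 0) := by
    rw [Metric.tendsto_nhds]
    intro ε hε
    filter_upwards [hℓsmall (ε / 2) (half_pos hε), eventually_gt_atTop 0] with N hN hN0
    have hN0' : (0 : ℝ) < N := by exact_mod_cast hN0
    rw [Real.dist_eq, sub_zero, abs_of_nonneg (by positivity), div_lt_iff₀ hN0']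
    nlinarith
  have h1 := (hℓlim.mul_const ((k : ℝ) * k)).const_sub 1
  rw [zero_mul, sub_zero] at h1
  refine h1.congr' ?_
  filter_upwards [hm, hsub, eventually_gt_atTop 0] with N h2 h3 h4
  have h4' : (N : ℝ) ≠ 0 := by exact_mod_cast h4.ne'
  rw [h2, Nat.cast_sub (by omega)]
  push_cast
  field_simp

omit [∀ j, DecidableEq (I j)] [∀ j, Fintype (J j)] [∀ j, DecidableEq (J j)] in
theorem kronAt_mulVec {ψ : Tensor I}
    {A : ∀ j, Matrix (J j) (I j) ℂ[T;T⁻¹]} {P : (∀ j, J j) → Polynomial ℂ}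
    (hP : kron A *ᵥ (fun y => LaurentPolynomial.C (ψ y)) = fun x => Polynomial.toLaurent (P x))
    (z : ℂˣ) (x : ∀ j, J j) : (kronAt A z *ᵥ ψ) x = (P x).eval (z : ℂ) := by
  have h := congrArg (LaurentPolynomial.eval₂ (RingHom.id ℂ) z) (congrFun hP x)
  rw [LaurentPolynomial.eval₂_toLaurent, Polynomial.eval₂_id] at h
  rw [← h, Matrix.mulVec, dotProduct, Matrix.mulVec, dotProduct, map_sum]
  refine Finset.sum_congr rfl fun y _ => ?_
  rw [map_mul, kronAt_apply, LaurentPolynomial.eval₂_C, RingHom.id_apply]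

omit [∀ j, DecidableEq (J j)] in
-- Near 0 the norm is bounded below because `A(z)ψ` tends to `φ ≠ 0`; elsewhere the previous lower
-- bound applies.
theorem IsDegeneration.exists_opNorm_kronAt_ge {ψ : Tensor I} (hψ : IsUnitVector ψ)
    {φ : Tensor J} (hφ : φ ≠ 0) {A : ∀ j, Matrix (J j) (I j) ℂ[T;T⁻¹]} {e : ℕ}
    (hdeg : IsDegeneration ψ φ A e) (hnz : ∀ z : ℂˣ, kronAt A z ≠ 0)
    (hpos : ∃ d : ℤ, 0 < d ∧ ∃ x y, (kron A x y).coeff d ≠ 0) :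
    ∃ c : ℝ, 0 < c ∧ ∀ z : ℂˣ, c ≤ opNorm (kronAt A z) := by
  obtain ⟨P, -, hP0, hP⟩ := hdeg
  obtain ⟨x, hx⟩ := Function.ne_iff.1 hφ
  have hx0 : 0 < ‖φ x‖ := norm_pos_iff.2 hx
  have hlim : Tendsto (fun z => ‖(P x).eval z‖) (𝓝 0) (𝓝 ‖φ x‖) := by
    have h := ((P x).continuous.norm.tendsto 0)
    rwa [← Polynomial.coeff_zero_eq_eval_zero, hP0] at h
  obtain ⟨δ, hδ, hball⟩ := Metric.eventually_nhds_iff.1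
    (hlim.eventually (lt_mem_nhds (half_lt_self hx0)))
  obtain ⟨c, hc, hcA⟩ := Degeneration.exists_opNorm_kronAt_ge hnz hpos hδ
  refine ⟨min c (‖φ x‖ / 2), lt_min hc (half_pos hx0), fun z => ?_⟩
  rcases le_or_gt δ ‖(z : ℂ)‖ with h | h
  · exact (min_le_left _ _).trans (hcA z h)
  · have h1 := hball (y := (z : ℂ)) (by simpa using h)
    refine (min_le_right _ _).trans (h1.le.trans ?_)
    have h2 := norm_mulVec_le (kronAt A z) ψ
    have h3 := PiLp.norm_apply_le (WithLp.toLp 2 (kronAt A z *ᵥ ψ) : EuclideanSpace ℂ _) x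
    have h4 : ‖(WithLp.toLp 2 ψ : EuclideanSpace ℂ (∀ j, I j))‖ = 1 := hψ
    rw [h4, mul_one] at h2
    refine le_trans (le_of_eq ?_) (h3.trans h2)
    rw [← kronAt_mulVec hP z x]

omit [∀ j, DecidableEq (J j)] in
-- Interpolating the constant 1 forces `∑ ‖w i‖ ≥ 1`, so the cost is at least `c ^ n`. This keeps
-- the infimum over measures from being `-∞`.
theorem Interpolates.logb_le {A : ∀ j, Matrix (J j) (I j) ℂ[T;T⁻¹]} {e : ℕ} {L c : ℝ}
    (hL : Interpolates A e L) (hc : 0 < c) (hcA : ∀ z : ℂˣ, c ≤ opNorm (kronAt A z)) :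
    Real.logb 2 c ≤ L := by
  refine le_of_forall_pos_le_add fun ε hε => ?_
  obtain ⟨n, ⟨X, _, z, w, -, hw, hM⟩, hn⟩ := ((hL ε hε).and (eventually_gt_atTop 0)).exists
  have h1 : ∑ i, w i = 1 := by simpa using hw 1 (by simp)
  have h2 : 1 ≤ ∑ i, ‖w i‖ := by
    have := norm_sum_le Finset.univ w
    rwa [h1, norm_one] at this
  have h3 : c ^ n ≤ (2 : ℝ) ^ (n * (L + ε)) := by
    refine le_trans ?_ hM
    calc c ^ n ≤ (∑ i, ‖w i‖) * c ^ n := le_mul_of_one_le_left (by positivity) h2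
      _ ≤ _ := by
        rw [Finset.sum_mul]
        exact Finset.sum_le_sum fun i _ => mul_le_mul_of_nonneg_left
          (pow_le_pow_left₀ hc.le (hcA _) n) (norm_nonneg _)
  rw [← Real.logb_le_iff_le_rpow one_lt_two (by positivity), Real.logb_pow] at h3
  exact le_of_mul_le_mul_left h3 (by exact_mod_cast hn)

omit [∀ j, DecidableEq (I j)] in
theorem IsUnitVector.ne_zero {ψ : Tensor I} (hψ : IsUnitVector ψ) : ψ ≠ 0 := by
  rintro rfl
  simp [IsUnitVector] at hψ

omit [∀ j, DecidableEq (J j)] in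
-- A finite infimum need not be attained, but it is approached from above, and `Interpolates` allows
-- an arbitrarily small loss. If the infimum is `∞`, any real exponent will do, for instance the one
-- from roots of unity.
theorem exists_interpolates_le_exponentBound {ψ : Tensor I} (hψ : IsUnitVector ψ)
    {φ : Tensor J} (hφ : φ ≠ 0) {A : ∀ j, Matrix (J j) (I j) ℂ[T;T⁻¹]} {e : ℕ}
    (hdeg : IsDegeneration ψ φ A e) (hnz : ∀ z : ℂˣ, kronAt A z ≠ 0)
    (hpos : ∃ d : ℤ, 0 < d ∧ ∃ x y, (kron A x y).coeff d ≠ 0) :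
    ∃ L : ℝ, ((2 * L : ℝ) : EReal) ≤ exponentBound A e ∧ Interpolates A e L := by
  have hlt : ∀ L : ℝ, (⨅ σ : ProbabilityMeasure ℂ, ⨆ z ∈ (σ : Measure ℂ).support,
      exponentAt A e σ z) < L → Interpolates A e L := by
    intro L h
    obtain ⟨σ, hσ⟩ := iInf_lt_iff.1 h
    exact interpolates_of_measure hnz hpos fun z hz => (le_iSup₂ z hz).trans hσ.le
  obtain ⟨c, hc, hcA⟩ := hdeg.exists_opNorm_kronAt_ge hψ hφ hnz hpos
  rw [exponentBound]
  set b := ⨅ σ : ProbabilityMeasure ℂ, ⨆ z ∈ (σ : Measure ℂ).support, exponentAt A e σ z with hb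
  rcases eq_or_ne b ⊤ with htop | htop
  · obtain ⟨L, hL⟩ := exists_interpolates A e
    refine ⟨L, ?_, hL⟩
    rw [htop, EReal.mul_top_of_pos (by norm_num)]
    exact le_top
  · have hbot : b ≠ ⊥ := by
      intro h
      have h1 := (hlt (Real.logb 2 c - 1) (h ▸ EReal.bot_lt_coe _)).logb_le hc hcA
      linarith
    lift b to ℝ using ⟨htop, hbot⟩ with R hR
    refine ⟨R, ?_, .of_forall_add fun ε hε => hlt _ (EReal.coe_lt_coe_iff.2 (by linarith))⟩
    rw [EReal.coe_mul]
    exact le_rfl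

end

end Degeneration

open Degeneration
theorem theorem1 {k : ℕ} {I J : Fin k → Type}
    [∀ j, Fintype (I j)] [∀ j, DecidableEq (I j)] [∀ j, Fintype (J j)] [∀ j, DecidableEq (J j)]
    (ψ : Tensor I) (φ : Tensor J) (hψ : IsUnitVector ψ) (hφ : IsUnitVector φ)
    (A : ∀ j, Matrix (J j) (I j) (LaurentPolynomial ℂ)) (e : ℕ)
    (hdeg : IsDegeneration ψ φ A e)
    (hnz : ∀ z : ℂˣ, kronAt A z ≠ 0)
    (hpos : ∃ d : ℤ, 0 < d ∧ ∃ x y, (kron A x y).coeff d ≠ 0)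
    (hneg : ∃ d : ℤ, d < 0 ∧ ∃ x y, (kron A x y).coeff d ≠ 0) :
    ∃ r : ℝ, (r : EReal) ≤ exponentBound A e ∧ AsymptoticallyTransforms ψ φ 1 r := by
  -- Without parties the empty tensor product is the constant 1, which has no term of positive
  -- degree.
  have hk : 0 < k := by
    obtain ⟨d, hd, x, y, hxy⟩ := hpos
    rcases Nat.eq_zero_or_pos k with rfl | hk
    · exfalso
      apply hxy
      rw [kron, Fin.prod_univ_zero, AddMonoidAlgebra.one_def, AddMonoidAlgebra.coeff_single,
        Finsupp.single_eq_of_ne hd.ne']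
    · exact hk
  obtain ⟨L, hL, hint⟩ :=
    exists_interpolates_le_exponentBound hψ hφ.ne_zero hdeg hnz hpos
  exact ⟨2 * L, hL, hdeg.asymptoticallyTransforms hk hψ.ne_zero hφ.ne_zero hnz hint⟩
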